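/- Let $M$ be a smooth manifold of finite dimension $n$, $TM$ its tangent bundle with induced coordinates $(x^i,y^i)$, and $\mathcal TM=TM\setminus\{0\}$ the slit tangent bundle. Let $J=dx^i\otimes\frac{\partial}{\partial y^i}$ be the vertical endomorphism, $C=y^i\frac{\partial}{\partial y^i}$ the Liouville vector field, and $d_Jf=df\circ J=\frac{\partial f}{\partial y^i}dx^i$. A function $f\colon TM\to\mathbb R$ is called $1$-homogeneous if $f(x,cy)=c\,f(x,y)$ for all $c>0$. A spray is a smooth vector field $S$ on $\mathcal TM$ with $JS=C$ and $[C,S]=S$. Its geodesics are the smooth curves $\gamma\colon I\to M$ ($I$ an open interval) with nowhere vanishing velocity and $S\circ\dot\gamma=\ddot\gamma$. Two sprays are projectively equivalent if their geodesics coincide up to orientation preserving reparametrization: every geodesic of either spray becomes a geodesic of the other one after composition with a smooth diffeomorphism of open intervals with positive derivative. A Finsler function is a continuous function $F\colon TM\to\mathbb R$ that is smooth and positive on $\mathcal TM$, $1$-homogeneous, and whose energy $E=\frac12F^2$ has a positive definite fibre Hessian $\frac{\partial^2E}{\partial y^i\partial y^j}$ on $\mathcal TM$. A spray $S$ is Finsler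 metrizable if there is a Finsler function whose energy $E$ satisfies $i_Sdd_JE+d\mathcal L_CE-dE=0$ on $\mathcal TM$, and projectively Finsler metrizable if it is projectively equivalent to a Finsler metrizable spray. **Proposition.** A spray $S$ on $M$ is projectively Finsler metrizable if and only if there exists a $1$-homogeneous function $\widetilde F\colon TM\to\mathbb R$, smooth on $\mathcal TM$, such that the matrix $\frac{\partial^2\widetilde F^2}{\partial y^i\partial y^j}$ is positive definite at every point of $\mathcal TM$ and $$i_S\,dd_J\widetilde F=0\quad\text{on }\mathcal TM .$$ -/

import Mathlib

open scoped Manifold ContDiff Topology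

noncomputable section

namespace SprayGeometry

/-- The tangent bundle `TM` of a manifold `M` modelled on the vector space `E`
(`E = ℝⁿ` for an `n`-dimensional manifold). -/
abbrev TM (E : Type*) [NormedAddCommGroup E] [NormedSpace ℝ E]
    (M : Type*) [TopologicalSpace M] [ChartedSpace E M] :=
  TangentBundle 𝓘(ℝ, E) M

/-- The model space of `TM`: pairs `(x, y)` of base and fibre coordinates. -/
abbrev ModelTM (E : Type*) := E × E

section Basic

variable {E : Type*} [NormedAddCommGroup E] [NormedSpace ℝ E]
  {M : Type*} [TopologicalSpace M] [ChartedSpace E M]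

/-- The slit tangent bundle: the nonzero tangent vectors, as a subset of `TM`. -/
def slit (E : Type*) [NormedAddCommGroup E] [NormedSpace ℝ E]
    (M : Type*) [TopologicalSpace M]
    [ChartedSpace E M] : Set (TM E M) :=
  {p | p.2 ≠ 0}

/-- A function on `TM` is (positively) 1-homogeneous: `F (x, c y) = c F (x, y)` for `c > 0`. -/
def IsOneHomogeneous (F : TM E M → ℝ) : Prop :=
  ∀ (p : TM E M) (c : ℝ), 0 < c → F ⟨p.1, c • p.2⟩ = c * F p

/-- The bilinear form `∂²f/∂yⁱ∂yʲ` at `p = (x, y)`: the second derivative at `y` of the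
restriction of `f` to the fibre `T_x M` (whose underlying vector space is `E`, the coordinates
being the induced fibre coordinates `yⁱ`). -/
def fibreHessian (f : TM E M → ℝ) (p : TM E M) (u w : E) : ℝ :=
  fderiv ℝ (fderiv ℝ (fun y : E => f ⟨p.1, y⟩)) p.2 u w

/-- `∂²f/∂yⁱ∂yʲ` is positive definite at every point of the slit tangent bundle. -/
def FibreHessianPosDef (f : TM E M → ℝ) : Prop :=
  ∀ p ∈ slit E M, ∀ u : E, u ≠ 0 → 0 < fibreHessian f p u u

/-- The velocity `γ'(t)`, a point of `TM`, of a curve in `M`. -/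
def velocity (E : Type*) [NormedAddCommGroup E] [NormedSpace ℝ E]
    {M : Type*} [TopologicalSpace M]
    [ChartedSpace E M] (γ : ℝ → M) (t : ℝ) : TM E M :=
  ⟨γ t, mfderiv 𝓘(ℝ, ℝ) 𝓘(ℝ, E) γ t (1 : ℝ)⟩

end Basic

section Smooth

variable {E : Type*} [NormedAddCommGroup E] [NormedSpace ℝ E]
  {M : Type*} [TopologicalSpace M] [ChartedSpace E M]
  [IsManifold 𝓘(ℝ, E) ∞ M]

/-- The differential of a real function on `TM`. -/
def dFun (f : TM E M → ℝ) (p : TM E M) : TangentSpace 𝓘(ℝ, E).tangent p →L[ℝ] ℝ :=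
  mfderiv 𝓘(ℝ, E).tangent 𝓘(ℝ, ℝ) f p

/-- The vertical lift `T_x M → T_p TM` at `p = (x, y)`: the derivative at `y` of the inclusion
of the fibre `T_x M` into `TM`. -/
def verticalLift (p : TM E M) :
    TangentSpace 𝓘(ℝ, E) p.1 →L[ℝ] TangentSpace 𝓘(ℝ, E).tangent p :=
  mfderiv 𝓘(ℝ, E) 𝓘(ℝ, E).tangent
    (fun y : E => (⟨p.1, y⟩ : TM E M)) p.2

/-- The differential of the projection `π : TM → M`. -/
def dProj (p : TM E M) : TangentSpace 𝓘(ℝ, E).tangent p →L[ℝ] TangentSpace 𝓘(ℝ, E) p.1 :=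
  mfderiv 𝓘(ℝ, E).tangent 𝓘(ℝ, E) (fun q : TM E M => q.1) p

/-- The vertical endomorphism `J = dxⁱ ⊗ ∂/∂yⁱ`. -/
def vertEndo (p : TM E M) :
    TangentSpace 𝓘(ℝ, E).tangent p →L[ℝ] TangentSpace 𝓘(ℝ, E).tangent p :=
  (verticalLift p).comp (dProj p)

/-- The Liouville vector field `C = yⁱ ∂/∂yⁱ`. -/
def liouville (p : TM E M) : TangentSpace 𝓘(ℝ, E).tangent p :=
  verticalLift p p.2

/-- The 1-form `d_J f = df ∘ J = (∂f/∂yⁱ) dxⁱ`. -/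
def dJ (f : TM E M → ℝ) (p : TM E M) : TangentSpace 𝓘(ℝ, E).tangent p →L[ℝ] ℝ :=
  (dFun f p).comp (vertEndo p)

/-- The exterior derivative `(dα)_p (u, w)` of a 1-form `α` on `TM`: the form is pulled back to
the model space by the inverse of the chart at `p`, differentiated there, and the result is
pulled back to `T_p TM`. -/
def dOneForm (α : (q : TM E M) → TangentSpace 𝓘(ℝ, E).tangent q →L[ℝ] ℝ) (p : TM E M)
    (u w : TangentSpace 𝓘(ℝ, E).tangent p) : ℝ :=
  extDeriv
    (fun z : ModelTM E =>
      ContinuousAlternatingMap.ofSubsingleton ℝ (ModelTM E) ℝ (0 : Fin 1)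
        ((α ((extChartAt 𝓘(ℝ, E).tangent p).symm z)).comp
          (mfderiv 𝓘(ℝ, ModelTM E) 𝓘(ℝ, E).tangent (extChartAt 𝓘(ℝ, E).tangent p).symm z)))
    (extChartAt 𝓘(ℝ, E).tangent p p)
    ![mfderiv 𝓘(ℝ, E).tangent 𝓘(ℝ, ModelTM E) (extChartAt 𝓘(ℝ, E).tangent p) p u,
      mfderiv 𝓘(ℝ, E).tangent 𝓘(ℝ, ModelTM E) (extChartAt 𝓘(ℝ, E).tangent p) p w]

/-- A spray: a vector field `S`, smooth on the slit tangent bundle, with `J S = C` and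
`[C, S] = S` there. (The values of `S` on the zero section are irrelevant.) -/
structure IsSpray (S : (p : TM E M) → TangentSpace 𝓘(ℝ, E).tangent p) : Prop where
  smooth : ContMDiffOn 𝓘(ℝ, E).tangent 𝓘(ℝ, E).tangent.tangent ∞
    (fun p => (⟨p, S p⟩ : TangentBundle 𝓘(ℝ, E).tangent (TM E M))) (slit E M)
  vertEndo_eq : ∀ p ∈ slit E M, vertEndo p (S p) = liouville p
  bracket_eq : ∀ p ∈ slit E M,
    VectorField.mlieBracket 𝓘(ℝ, E).tangent (liouville (E := E) (M := M)) S p = S p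

/-- `γ` is, on the open interval `I`, a geodesic of the spray `S`: a smooth regular curve whose
velocity satisfies `S ∘ γ' = γ''`. (The values of `γ` outside `I` are irrelevant.) -/
structure IsGeodesicOn (S : (p : TM E M) → TangentSpace 𝓘(ℝ, E).tangent p)
    (γ : ℝ → M) (I : Set ℝ) : Prop where
  isOpen : IsOpen I
  ordConnected : I.OrdConnected
  smooth : ContMDiffOn 𝓘(ℝ, ℝ) 𝓘(ℝ, E) ∞ γ I
  regular : ∀ t ∈ I, velocity E γ t ∈ slit E M
  integral : IsMIntegralCurveOn (I := 𝓘(ℝ, E).tangent) (velocity E γ) S I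

/-- Every geodesic of `S` becomes a geodesic of `S'` after an orientation preserving
reparametrization (a smooth diffeomorphism `φ` with `φ' > 0` between open intervals). -/
def GeodesicsReparametrizeTo (S S' : (p : TM E M) → TangentSpace 𝓘(ℝ, E).tangent p) : Prop :=
  ∀ (γ : ℝ → M) (I : Set ℝ), IsGeodesicOn S γ I →
    ∃ (φ : ℝ → ℝ) (K : Set ℝ), IsOpen K ∧ K.OrdConnected ∧ ContDiffOn ℝ ∞ φ K ∧
      (∀ s ∈ K, 0 < deriv φ s) ∧ φ '' K = I ∧ IsGeodesicOn S' (γ ∘ φ) K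

/-- Two sprays are projectively equivalent: their geodesics coincide up to orientation
preserving reparametrization. -/
def ProjectivelyEquivalent (S S' : (p : TM E M) → TangentSpace 𝓘(ℝ, E).tangent p) : Prop :=
  GeodesicsReparametrizeTo S S' ∧ GeodesicsReparametrizeTo S' S

/-- The energy `F² / 2`. -/
def energy (F : TM E M → ℝ) (p : TM E M) : ℝ := F p ^ 2 / 2

/-- A Finsler function: continuous on `TM`, smooth and positive on the slit tangent bundle,
1-homogeneous, and strongly convex on the fibres: `g_ij = ∂²(F²/2)/∂yⁱ∂yʲ` is positive definite. -/
structure IsFinslerFunction (F : TM E M → ℝ) : Prop where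
  continuous : Continuous F
  smooth : ContMDiffOn 𝓘(ℝ, E).tangent 𝓘(ℝ, ℝ) ∞ F (slit E M)
  pos : ∀ p ∈ slit E M, 0 < F p
  homogeneous : IsOneHomogeneous F
  posDef : FibreHessianPosDef (energy F)

/-- The Euler-Lagrange form `ω_L = i_S d d_J L + d (𝓛_C L) - dL` of a function `L` on `TM`,
evaluated at `w ∈ T_p TM`; here `𝓛_C L = dL (C)`. -/
def eulerLagrangeForm (S : (p : TM E M) → TangentSpace 𝓘(ℝ, E).tangent p) (L : TM E M → ℝ)
    (p : TM E M) (w : TangentSpace 𝓘(ℝ, E).tangent p) : ℝ :=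
  dOneForm (dJ L) p (S p) w + dFun (fun q => dFun L q (liouville q)) p w - dFun L p w

/-- `S` is Finsler metrizable: it is the geodesic spray of a Finsler function, that is
`ω_L = 0` on the slit tangent bundle for the energy `L = F² / 2` of some Finsler function `F`. -/
def IsFinslerMetrizable (S : (p : TM E M) → TangentSpace 𝓘(ℝ, E).tangent p) : Prop :=
  ∃ F : TM E M → ℝ, IsFinslerFunction F ∧
    ∀ p ∈ slit E M, ∀ w, eulerLagrangeForm S (energy F) p w = 0

/-- `S` is projectively Finsler metrizable: it is projectively equivalent to a Finsler
metrizable spray. -/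
def IsProjectivelyFinslerMetrizable (S : (p : TM E M) → TangentSpace 𝓘(ℝ, E).tangent p) : Prop :=
  ∃ S' : (p : TM E M) → TangentSpace 𝓘(ℝ, E).tangent p,
    IsSpray S' ∧ ProjectivelyEquivalent S S' ∧ IsFinslerMetrizable S'

/-- The Rapcsák equation `i_S d d_J F = 0` on the slit tangent bundle. -/
def RapcsakEquation (S : (p : TM E M) → TangentSpace 𝓘(ℝ, E).tangent p) (F : TM E M → ℝ) : Prop :=
  ∀ p ∈ slit E M, ∀ w, dOneForm (dJ F) p (S p) w = 0

end Smooth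

end SprayGeometry

end

/-! Two facts carry the theorem.

The first is geometric: sprays have the same oriented geodesics exactly when they differ by a
multiple of `C`. The bracket condition makes the coefficients of a spray 2-homogeneous in `y`
(`IsSpray.localField_smul`). Along `γ ∘ φ` the acceleration has fibre part `φ'' y + φ'² s(y)`, where
`s` is the fibre part of `S`. If `γ ∘ φ` is a geodesic of `S'`, this equals `S'` at `φ' y`, whose
fibre part is `φ'² s'(y)`, so `S' = S + (φ''/φ'²) C` at that point. A geodesic passes through every
slit vector by Picard–Lindelöf. Conversely, for smooth 1-homogeneous `a`, the field `S - a C` is a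
spray, and solving `φ'' = -a(γ'(φ)) φ'²` turns geodesics of `S` into its geodesics.

The second is algebraic. For 1-homogeneous `F` and `JS = C`, Euler's identity `C F = F` and `dd_J
(F²/2) = dF ∧ d_J F + F dd_J F` give `ω_E = S(F) d_J F + F i_S dd_J F` (`eulerLagrangeForm_energy`),
while `i_C dd_J F = 0` (`ddJ_vertical`), so the Rapcsák equation does not change under `S ↦ S - a
C`.

If `S'` is the geodesic spray of `F`, evaluating `ω_E = 0` on `S'` itself gives `S'(F) = 0`. Hence
`i_{S'} dd_J F = 0`, and the same holds for any projectively equivalent `S`. Conversely, given a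
solution `F` for `S`, put `S' = S - (S(F)/F) C`; then `S'(F) = 0` and both terms of `ω_E` vanish.
The division is legitimate because `∂²F²/∂y²` evaluated on `(y, y)` is `2F²`, so definiteness forces
`F ≠ 0`. The sign of `F` is harmless, since `|F|` has the same energy and is a Finsler function. -/

noncomputable section

namespace SprayGeometry

/-! ### Induced charts of `TM`; `J` and `C` in coordinates. -/

section Charts
variable {E : Type*} [NormedAddCommGroup E] [NormedSpace ℝ E]
  {M : Type*} [TopologicalSpace M] [ChartedSpace E M]
  [IsManifold 𝓘(ℝ, E) ∞ M]

/-- The chart of `TM` induced by the preferred chart of `M` at `x₀`. -/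
def tchart (E : Type*) [NormedAddCommGroup E] [NormedSpace ℝ E] {M : Type*} [TopologicalSpace M]
    [ChartedSpace E M] [IsManifold 𝓘(ℝ, E) ∞ M] (x₀ : M) : PartialEquiv (TM E M) (E × E) :=
  extChartAt 𝓘(ℝ, E).tangent (⟨x₀, 0⟩ : TM E M)

theorem mem_tchart_source {x₀ : M} {q : TM E M} :
    q ∈ (tchart E x₀).source ↔ q.1 ∈ (chartAt E x₀).source := by
  rw [tchart, extChartAt_source]
  exact TangentBundle.mem_chart_source_iff _ _

theorem tchart_target (x₀ : M) :
    (tchart E x₀).target = (extChartAt 𝓘(ℝ, E) x₀).target ×ˢ Set.univ := by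
  rw [tchart, FiberBundle.extChartAt_target]
  congr 1
  apply Set.inter_eq_left.2
  intro x hx
  have := (extChartAt 𝓘(ℝ, E) x₀).map_target hx
  rwa [extChartAt_source] at this

theorem isOpen_tchart_target (x₀ : M) : IsOpen (tchart E x₀).target :=
  isOpen_extChartAt_target _

theorem isOpen_tchart_source (x₀ : M) : IsOpen (tchart E x₀).source :=
  isOpen_extChartAt_source _

/-- The derivative of the preferred chart of `M` at `x₀`, as an endomorphism of the model. -/
def chartDeriv (E : Type*) [NormedAddCommGroup E] [NormedSpace ℝ E] {M : Type*}
    [TopologicalSpace M] [ChartedSpace E M] (x₀ x : M) : E →L[ℝ] E :=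
  mfderiv 𝓘(ℝ, E) 𝓘(ℝ, E) (extChartAt 𝓘(ℝ, E) x₀) x

theorem tchart_apply {x₀ : M} {q : TM E M} (hq : q.1 ∈ (chartAt E x₀).source) :
    tchart E x₀ q = (extChartAt 𝓘(ℝ, E) x₀ q.1, chartDeriv E x₀ q.1 q.2) := by
  rw [tchart, FiberBundle.extChartAt, chartDeriv,
    ← TangentBundle.continuousLinearMapAt_trivializationAt hq]
  have h := (trivializationAt E (TangentSpace 𝓘(ℝ, E)) x₀).coe_linearMapAt_of_mem (R := ℝ)
    (b := q.1) hq
  have h2 : (trivializationAt E (TangentSpace 𝓘(ℝ, E)) x₀).continuousLinearMapAt ℝ q.1 q.2 =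
    ((trivializationAt E (TangentSpace 𝓘(ℝ, E)) x₀) ⟨q.1, q.2⟩).2 := congrFun h q.2
  exact Prod.ext rfl h2.symm

theorem injective_chartDeriv {x₀ x : M} (hx : x ∈ (chartAt E x₀).source) :
    Function.Injective (chartDeriv E x₀ x) :=
  (isInvertible_mfderiv_extChartAt (I := 𝓘(ℝ, E))
    (by rwa [extChartAt_source] : x ∈ (extChartAt 𝓘(ℝ, E) x₀).source)).injective

/-- The derivative of the induced chart of `TM`. -/
def dchart (x₀ : M) (q : TM E M) : TangentSpace 𝓘(ℝ, E).tangent q →L[ℝ] E × E :=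
  mfderiv 𝓘(ℝ, E).tangent 𝓘(ℝ, E × E) (tchart E x₀) q

/-- The derivative of the inverse of the induced chart of `TM`. -/
def dchartSymm (x₀ : M) (z : E × E) :
    E × E →L[ℝ] TangentSpace 𝓘(ℝ, E).tangent ((tchart E x₀).symm z) :=
  mfderiv 𝓘(ℝ, E × E) 𝓘(ℝ, E).tangent (tchart E x₀).symm z

theorem dchart_dchartSymm {x₀ : M} {z : E × E} (hz : z ∈ (tchart E x₀).target) (u : E × E) :
    dchart x₀ ((tchart E x₀).symm z) (dchartSymm x₀ z u) = u := by
  have h := mfderiv_extChartAt_comp_mfderivWithin_extChartAt_symm (I := 𝓘(ℝ, E).tangent) hz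
  rw [ModelWithCorners.range_eq_univ, mfderivWithin_univ] at h
  exact DFunLike.congr_fun h u

theorem dchartSymm_dchart {x₀ : M} {z : E × E} (hz : z ∈ (tchart E x₀).target)
    (u : TangentSpace 𝓘(ℝ, E).tangent ((tchart E x₀).symm z)) :
    dchartSymm x₀ z (dchart x₀ ((tchart E x₀).symm z) u) = u := by
  have h := mfderivWithin_extChartAt_symm_comp_mfderiv_extChartAt (I := 𝓘(ℝ, E).tangent) hz
  rw [ModelWithCorners.range_eq_univ, mfderivWithin_univ] at h
  exact DFunLike.congr_fun h u

theorem injective_dchart {x₀ : M} {q : TM E M} (hq : q.1 ∈ (chartAt E x₀).source) :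
    Function.Injective (dchart x₀ q) :=
  (isInvertible_mfderiv_extChartAt (I := 𝓘(ℝ, E).tangent)
    (mem_tchart_source.2 hq)).injective

theorem contMDiffOn_tchart (x₀ : M) :
    ContMDiffOn 𝓘(ℝ, E).tangent 𝓘(ℝ, E × E) ∞ (tchart E x₀) (tchart E x₀).source := by
  have := contMDiffOn_extChartAt (I := 𝓘(ℝ, E).tangent) (n := ∞) (x := (⟨x₀, 0⟩ : TM E M))
  rwa [← extChartAt_source 𝓘(ℝ, E).tangent] at this

theorem contMDiffOn_tchart_symm (x₀ : M) :
    ContMDiffOn 𝓘(ℝ, E × E) 𝓘(ℝ, E).tangent ∞ (tchart E x₀).symm (tchart E x₀).target :=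
  contMDiffOn_extChartAt_symm _

theorem contMDiffAt_tchart {x₀ : M} {q : TM E M} (hq : q.1 ∈ (chartAt E x₀).source) :
    ContMDiffAt 𝓘(ℝ, E).tangent 𝓘(ℝ, E × E) ∞ (tchart E x₀) q :=
  (contMDiffOn_tchart x₀).contMDiffAt ((isOpen_tchart_source x₀).mem_nhds (mem_tchart_source.2 hq))

theorem contMDiffAt_tchart_symm {x₀ : M} {z : E × E} (hz : z ∈ (tchart E x₀).target) :
    ContMDiffAt 𝓘(ℝ, E × E) 𝓘(ℝ, E).tangent ∞ (tchart E x₀).symm z :=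
  (contMDiffOn_tchart_symm x₀).contMDiffAt ((isOpen_tchart_target x₀).mem_nhds hz)

theorem tchart_mem_target {x₀ : M} {q : TM E M} (hq : q.1 ∈ (chartAt E x₀).source) :
    tchart E x₀ q ∈ (tchart E x₀).target := (tchart E x₀).map_source (mem_tchart_source.2 hq)

theorem tchart_symm_tchart {x₀ : M} {q : TM E M} (hq : q.1 ∈ (chartAt E x₀).source) :
    (tchart E x₀).symm (tchart E x₀ q) = q := (tchart E x₀).left_inv (mem_tchart_source.2 hq)

theorem tchart_symm_proj_mem {x₀ : M} {z : E × E} (hz : z ∈ (tchart E x₀).target) :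
    ((tchart E x₀).symm z).1 ∈ (chartAt E x₀).source :=
  mem_tchart_source.1 ((tchart E x₀).map_target hz)

theorem tchart_snd_eq_zero_iff {x₀ : M} {q : TM E M} (hq : q.1 ∈ (chartAt E x₀).source) :
    (tchart E x₀ q).2 = 0 ↔ q.2 = 0 := by
  rw [tchart_apply hq]
  exact map_eq_zero_iff _ (injective_chartDeriv hq)

/-- The slit part of the target of the induced chart. -/
def slitTarget (E : Type*) [NormedAddCommGroup E] [NormedSpace ℝ E] {M : Type*}
    [TopologicalSpace M] [ChartedSpace E M] [IsManifold 𝓘(ℝ, E) ∞ M] (x₀ : M) : Set (E × E) :=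
  {z | z ∈ (tchart E x₀).target ∧ z.2 ≠ 0}

theorem isOpen_slitTarget (x₀ : M) : IsOpen (slitTarget E x₀) :=
  (isOpen_tchart_target x₀).inter (isOpen_compl_singleton.preimage continuous_snd)

theorem tchart_mem_slitTarget {x₀ : M} {q : TM E M} (hq : q.1 ∈ (chartAt E x₀).source)
    (h : q ∈ slit E M) : tchart E x₀ q ∈ slitTarget E x₀ :=
  ⟨tchart_mem_target hq, fun h0 => h ((tchart_snd_eq_zero_iff hq).1 h0)⟩

theorem tchart_symm_mem_slit {x₀ : M} {z : E × E} (hz : z ∈ slitTarget E x₀) :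
    (tchart E x₀).symm z ∈ slit E M := fun h0 => hz.2 <| by
  rw [← (tchart E x₀).right_inv hz.1]
  exact (tchart_snd_eq_zero_iff (tchart_symm_proj_mem hz.1)).2 h0

theorem eventually_proj_mem {x₀ : M} {q : TM E M} (hq : q.1 ∈ (chartAt E x₀).source) :
    ∀ᶠ q' in 𝓝 q, q'.1 ∈ (chartAt E x₀).source := by
  filter_upwards [(isOpen_tchart_source x₀).mem_nhds (mem_tchart_source.2 hq)] with q' h
  exact mem_tchart_source.1 h

theorem isOpen_slit : IsOpen (slit E M) := by
  rw [isOpen_iff_mem_nhds]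
  intro q hq
  have hs : q.1 ∈ (chartAt E q.1).source := mem_chart_source _ _
  filter_upwards [eventually_proj_mem hs, (contMDiffAt_tchart hs).continuousAt.preimage_mem_nhds
    ((isOpen_slitTarget q.1).mem_nhds (tchart_mem_slitTarget hs hq))] with q' h1 h2
  exact fun h0 => h2.2 ((tchart_snd_eq_zero_iff h1).2 h0)

/-- The base component of the induced chart is the chart of `M` composed with the projection; the
chain rule applied to both sides gives the identity. -/
theorem dchart_fst {x₀ : M} {q : TM E M} (hq : q.1 ∈ (chartAt E x₀).source)
    (u : TangentSpace 𝓘(ℝ, E).tangent q) :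
    (dchart x₀ q u).1 = chartDeriv E x₀ q.1 (dProj q u) := by
  have hΦ : MDifferentiableAt 𝓘(ℝ, E).tangent 𝓘(ℝ, E × E) (tchart E x₀) q :=
    (contMDiffAt_tchart hq).mdifferentiableAt (by simp)
  have hπ : MDifferentiableAt 𝓘(ℝ, E).tangent 𝓘(ℝ, E) (fun q : TM E M => q.1) q :=
    (Bundle.contMDiff_proj (TangentSpace 𝓘(ℝ, E))).contMDiffAt.mdifferentiableAt (n := ∞) (by simp)
  have hc : MDifferentiableAt 𝓘(ℝ, E) 𝓘(ℝ, E) (extChartAt 𝓘(ℝ, E) x₀) q.1 :=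
    mdifferentiableAt_extChartAt hq
  have hfst : MDifferentiableAt 𝓘(ℝ, E × E) 𝓘(ℝ, E) (Prod.fst : E × E → E) (tchart E x₀ q) :=
    mdifferentiableAt_iff_differentiableAt.2 differentiableAt_fst
  have h1 := mfderiv_comp q hfst hΦ
  have h2 := mfderiv_comp q hc hπ
  have h3 : (Prod.fst ∘ tchart E x₀) =ᶠ[𝓝 q]
      (extChartAt 𝓘(ℝ, E) x₀ ∘ fun q : TM E M => q.1) := by
    filter_upwards [eventually_proj_mem hq] with q' h
    simp [tchart_apply h]
  have h4 := h3.mfderiv_eq (I := 𝓘(ℝ, E).tangent) (I' := 𝓘(ℝ, E))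
  rw [mfderiv_eq_fderiv, fderiv_fst] at h1
  have h5 := DFunLike.congr_fun (h1.symm.trans (h4.trans h2)) u
  exact h5

theorem tchart_symm_fibre {x₀ x : M} (hx : x ∈ (chartAt E x₀).source) (y : E) :
    (⟨x, y⟩ : TM E M) =
      (tchart E x₀).symm (extChartAt 𝓘(ℝ, E) x₀ x, chartDeriv E x₀ x y) := by
  rw [← tchart_symm_tchart (x₀ := x₀) (q := ⟨x, y⟩) hx, tchart_apply hx]

theorem contMDiff_fibreIncl (x : M) :
    ContMDiff 𝓘(ℝ, E) 𝓘(ℝ, E).tangent ∞ (fun y : E => (⟨x, y⟩ : TM E M)) := by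
  intro y
  have hx : x ∈ (chartAt E x).source := mem_chart_source _ _
  have : (fun y : E => (⟨x, y⟩ : TM E M)) = (tchart E x).symm ∘
      fun y => (extChartAt 𝓘(ℝ, E) x x, chartDeriv E x x y) := by
    funext y; exact tchart_symm_fibre hx y
  rw [this]
  refine ContMDiffAt.comp _ (I' := 𝓘(ℝ, E × E)) (contMDiffAt_tchart_symm ?_) ?_
  · have := tchart_mem_target (x₀ := x) (q := ⟨x, y⟩) hx
    rwa [tchart_apply hx] at this
  · rw [contMDiffAt_iff_contDiffAt]; fun_prop

theorem dchart_mfderiv_fibreIncl {x₀ x : M} (hx : x ∈ (chartAt E x₀).source) (y v : E) :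
    dchart x₀ (⟨x, y⟩ : TM E M)
      (mfderiv 𝓘(ℝ, E) 𝓘(ℝ, E).tangent (fun y : E => (⟨x, y⟩ : TM E M)) y v) =
      (0, chartDeriv E x₀ x v) := by
  have hΦ : MDifferentiableAt 𝓘(ℝ, E).tangent 𝓘(ℝ, E × E) (tchart E x₀) (⟨x, y⟩ : TM E M) :=
    (contMDiffAt_tchart hx).mdifferentiableAt (by simp)
  have h1 := mfderiv_comp (f := fun y : E => (⟨x, y⟩ : TM E M)) y hΦ
    ((contMDiff_fibreIncl x y).mdifferentiableAt (by simp))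
  have h2 : tchart E x₀ ∘ (fun y : E => (⟨x, y⟩ : TM E M)) =
      fun y => (extChartAt 𝓘(ℝ, E) x₀ x, chartDeriv E x₀ x y) := by
    funext y; exact tchart_apply (q := ⟨x, y⟩) hx
  have h3 : HasFDerivAt (fun y : E => (extChartAt 𝓘(ℝ, E) x₀ x, chartDeriv E x₀ x y))
    ((0 : E →L[ℝ] E).prod (chartDeriv E x₀ x)) y :=
    (hasFDerivAt_const _ _).prodMk (chartDeriv E x₀ x).hasFDerivAt
  rw [h2, mfderiv_eq_fderiv, h3.fderiv] at h1
  exact (DFunLike.congr_fun h1 v).symm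

theorem dchart_verticalLift {x₀ : M} {q : TM E M} (hq : q.1 ∈ (chartAt E x₀).source)
    (v : TangentSpace 𝓘(ℝ, E) q.1) :
    dchart x₀ q (verticalLift q v) = (0, chartDeriv E x₀ q.1 v) :=
  dchart_mfderiv_fibreIncl hq q.2 v

theorem dchart_vertEndo {x₀ : M} {q : TM E M} (hq : q.1 ∈ (chartAt E x₀).source)
    (u : TangentSpace 𝓘(ℝ, E).tangent q) :
    dchart x₀ q (vertEndo q u) = (0, (dchart x₀ q u).1) := by
  rw [dchart_fst hq]
  exact dchart_verticalLift hq _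

theorem dchart_liouville {x₀ : M} {q : TM E M} (hq : q.1 ∈ (chartAt E x₀).source) :
    dchart x₀ q (liouville q) = (0, (tchart E x₀ q).2) := by
  rw [tchart_apply hq]
  exact dchart_verticalLift hq _

end Charts

/-! ### Coordinate expression of `dd_J f`. -/

section Forms

/-- The exterior derivative of `d_J g`, evaluated on two vectors in coordinates `(x, y)`. -/
def ddJ {E : Type*} [NormedAddCommGroup E] [NormedSpace ℝ E] (g : E × E → ℝ) (z u w : E × E) : ℝ :=
  fderiv ℝ (fderiv ℝ g) z u (0, w.1) - fderiv ℝ (fderiv ℝ g) z w (0, u.1)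

theorem extDeriv_oneForm_apply {V : Type*} [NormedAddCommGroup V] [NormedSpace ℝ V]
    (L : V → V →L[ℝ] ℝ) (z u w : V) :
    extDeriv (fun z => ContinuousAlternatingMap.ofSubsingleton ℝ V ℝ (0 : Fin 1) (L z)) z ![u, w] =
      fderiv ℝ L z u w - fderiv ℝ L z w u := by
  have h : (fun z => ContinuousAlternatingMap.ofSubsingleton ℝ V ℝ (0 : Fin 1) (L z)) =
    (ContinuousAlternatingMap.ofSubsingletonLIE (𝕜 := ℝ) (E := V) (F := ℝ) (0 : Fin 1)) ∘ L := rfl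
  rw [h, extDeriv, LinearIsometryEquiv.comp_fderiv,
    ContinuousAlternatingMap.alternatizeUncurryFin_apply]
  simp [Fin.sum_univ_two, sub_eq_add_neg]
  rfl

variable {E : Type*} [NormedAddCommGroup E] [NormedSpace ℝ E]
  {M : Type*} [TopologicalSpace M] [ChartedSpace E M]
  [IsManifold 𝓘(ℝ, E) ∞ M]

/-- The coordinate expression of a function on `TM`. -/
def localFun (f : TM E M → ℝ) (x₀ : M) (z : E × E) : ℝ := f ((tchart E x₀).symm z)

/-- The coordinate expression of a vector field on `TM`. -/
def localField (S : (p : TM E M) → TangentSpace 𝓘(ℝ, E).tangent p) (x₀ : M) (z : E × E) : E × E :=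
  dchart x₀ ((tchart E x₀).symm z) (S ((tchart E x₀).symm z))

theorem localFun_tchart {f : TM E M → ℝ} {x₀ : M} {q : TM E M}
    (hq : q.1 ∈ (chartAt E x₀).source) : localFun f x₀ (tchart E x₀ q) = f q := by
  rw [localFun, tchart_symm_tchart hq]

theorem localField_tchart {S : (p : TM E M) → TangentSpace 𝓘(ℝ, E).tangent p} {x₀ : M} {q : TM E M}
    (hq : q.1 ∈ (chartAt E x₀).source) :
    localField S x₀ (tchart E x₀ q) = dchart x₀ q (S q) := by
  rw [localField, tchart_symm_tchart hq]

theorem contDiffAt_localFun {f : TM E M → ℝ} {x₀ : M} {z : E × E} (hz : z ∈ (tchart E x₀).target)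
    (hf : ContMDiffAt 𝓘(ℝ, E).tangent 𝓘(ℝ, ℝ) ∞ f ((tchart E x₀).symm z)) :
    ContDiffAt ℝ ∞ (localFun f x₀) z :=
  (ContMDiffAt.comp z hf (contMDiffAt_tchart_symm hz)).contDiffAt

theorem contDiffOn_localFun {f : TM E M → ℝ}
    (hf : ContMDiffOn 𝓘(ℝ, E).tangent 𝓘(ℝ, ℝ) ∞ f (slit E M)) (x₀ : M) :
    ContDiffOn ℝ ∞ (localFun f x₀) (slitTarget E x₀) := fun _ hz =>
  (contDiffAt_localFun hz.1 (hf.contMDiffAt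
    (isOpen_slit.mem_nhds (tchart_symm_mem_slit hz)))).contDiffWithinAt

theorem dFun_eq {f : TM E M → ℝ} {x₀ : M} {q : TM E M} (hq : q.1 ∈ (chartAt E x₀).source)
    (hf : ContMDiffAt 𝓘(ℝ, E).tangent 𝓘(ℝ, ℝ) ∞ f q) (u : TangentSpace 𝓘(ℝ, E).tangent q) :
    dFun f q u = fderiv ℝ (localFun f x₀) (tchart E x₀ q) (dchart x₀ q u) := by
  have hg : ContDiffAt ℝ ∞ (localFun f x₀) (tchart E x₀ q) :=
    contDiffAt_localFun (tchart_mem_target hq) (by rwa [tchart_symm_tchart hq])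
  have h1 := mfderiv_comp (I'' := 𝓘(ℝ, ℝ)) q
    (mdifferentiableAt_iff_differentiableAt.2 (hg.differentiableAt (by simp)))
    ((contMDiffAt_tchart hq).mdifferentiableAt (by simp))
  have h2 : localFun f x₀ ∘ tchart E x₀ =ᶠ[𝓝 q] f := by
    filter_upwards [eventually_proj_mem hq] with q' h
    exact localFun_tchart h
  have h3 := h2.mfderiv_eq (I := 𝓘(ℝ, E).tangent) (I' := 𝓘(ℝ, ℝ))
  rw [mfderiv_eq_fderiv] at h1
  exact DFunLike.congr_fun (h3.symm.trans h1) u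

theorem dJ_dchartSymm {f : TM E M → ℝ} {x₀ : M} {z : E × E} (hz : z ∈ (tchart E x₀).target)
    (hf : ContMDiffAt 𝓘(ℝ, E).tangent 𝓘(ℝ, ℝ) ∞ f ((tchart E x₀).symm z)) :
    (dJ f ((tchart E x₀).symm z)).comp (dchartSymm x₀ z) =
      (fderiv ℝ (localFun f x₀) z).comp
        ((ContinuousLinearMap.inr ℝ E E).comp (ContinuousLinearMap.fst ℝ E E)) := by
  refine ContinuousLinearMap.ext fun u => ?_
  have h := tchart_symm_proj_mem hz
  change dFun f _ (vertEndo _ (dchartSymm x₀ z u)) = fderiv ℝ (localFun f x₀) z (0, u.1)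
  rw [dFun_eq h hf, dchart_vertEndo h, dchart_dchartSymm hz, (tchart E x₀).right_inv hz]

theorem dOneForm_dJ {f : TM E M → ℝ} (hf : ContMDiffOn 𝓘(ℝ, E).tangent 𝓘(ℝ, ℝ) ∞ f (slit E M))
    {p : TM E M} (hp : p ∈ slit E M) (u w : TangentSpace 𝓘(ℝ, E).tangent p) :
    dOneForm (dJ f) p u w =
      ddJ (localFun f p.1) (tchart E p.1 p) (dchart p.1 p u) (dchart p.1 p w) := by
  have hs : p.1 ∈ (chartAt E p.1).source := mem_chart_source _ _
  have hz := tchart_mem_slitTarget hs hp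
  have h1 : (fun z => (dJ f ((tchart E p.1).symm z)).comp (dchartSymm p.1 z)) =ᶠ[
      𝓝 (tchart E p.1 p)] fun z => (fderiv ℝ (localFun f p.1) z).comp
        ((ContinuousLinearMap.inr ℝ E E).comp (ContinuousLinearMap.fst ℝ E E)) := by
    filter_upwards [(isOpen_slitTarget p.1).mem_nhds hz] with z hz
    exact dJ_dchartSymm hz.1 (hf.contMDiffAt (isOpen_slit.mem_nhds (tchart_symm_mem_slit hz)))
  have h2 := extDeriv_oneForm_apply
    (fun z => (dJ f ((tchart E p.1).symm z)).comp (dchartSymm p.1 z))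
    (tchart E p.1 p) (dchart p.1 p u) (dchart p.1 p w)
  rw [h1.fderiv_eq] at h2
  -- The chart of `TM` at `p` depends only on the base point of `p`, so the chart used in `dOneForm`
  -- is definitionally `tchart E p.1`.
  refine Eq.trans h2 ?_
  have hd : DifferentiableAt ℝ (fderiv ℝ (localFun f p.1)) (tchart E p.1 p) :=
    (((contDiffOn_localFun hf p.1).contDiffAt ((isOpen_slitTarget p.1).mem_nhds hz)).fderiv_right
      (m := 1) (by norm_cast)).differentiableAt (by simp)
  have h3 := (hd.hasFDerivAt.clm_comp (hasFDerivAt_const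
    ((ContinuousLinearMap.inr ℝ E E).comp (ContinuousLinearMap.fst ℝ E E)) _)).fderiv
  rw [h3]
  simp [ddJ]

end Forms

/-! ### Euler identities for homogeneous functions on `E × E`. -/

section Euler
variable {E : Type*} [NormedAddCommGroup E] [NormedSpace ℝ E]
  {G : Type*} [NormedAddCommGroup G] [NormedSpace ℝ G]

theorem hasDerivAt_ray (x y : E) (c : ℝ) :
    HasDerivAt (fun c : ℝ => (x, c • y)) ((0, y) : E × E) c := by
  simpa using (hasDerivAt_const c x).prodMk ((hasDerivAt_id c).smul_const y)

theorem fderiv_vertical_of_homogeneous {f : E × E → G} {z : E × E} {k : ℕ}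
    (hf : DifferentiableAt ℝ f z) (hom : ∀ c : ℝ, 0 < c → f (z.1, c • z.2) = c ^ k • f z) :
    fderiv ℝ f z (0, z.2) = (k : ℝ) • f z := by
  have h1 : HasDerivAt (fun c : ℝ => f (z.1, c • z.2)) (fderiv ℝ f z (0, z.2)) 1 := by
    refine HasFDerivAt.comp_hasDerivAt (x := (1 : ℝ)) (f := fun c : ℝ => (z.1, c • z.2)) ?_
      (hasDerivAt_ray z.1 z.2 1)
    simpa using hf.hasFDerivAt
  have h2 : HasDerivAt (fun c : ℝ => c ^ k • f z) ((k : ℝ) • f z) 1 := by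
    simpa using (hasDerivAt_pow k (1 : ℝ)).smul_const (f z)
  refine h1.unique (h2.congr_of_eventuallyEq ?_)
  filter_upwards [lt_mem_nhds one_pos] with c hc
  exact hom c hc

/-- Converse of Euler's theorem: along a ray, `t⁻² f(x, t y)` has zero derivative on `(0, ∞)`, so it
equals its value at `t = 1`. -/
theorem homogeneous_two_of_fderiv_vertical {f : E × E → G} {x y : E}
    (hf : ∀ c : ℝ, 0 < c → DifferentiableAt ℝ f (x, c • y))
    (h : ∀ c : ℝ, 0 < c → fderiv ℝ f (x, c • y) (0, c • y) = (2 : ℝ) • f (x, c • y))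
    {c : ℝ} (hc : 0 < c) : f (x, c • y) = c ^ 2 • f (x, y) := by
  have key : ∀ t ∈ Set.Ioi (0 : ℝ),
      HasDerivAt (fun t : ℝ => (t ^ 2)⁻¹ • f (x, t • y)) 0 t := by
    intro t ht
    have ht0 : (0 : ℝ) < t := ht
    have h1 : HasDerivAt (fun t : ℝ => f (x, t • y)) (fderiv ℝ f (x, t • y) (0, y)) t :=
      HasFDerivAt.comp_hasDerivAt (x := t) (f := fun c : ℝ => (x, c • y))
        (hf t ht0).hasFDerivAt (hasDerivAt_ray x y t)
    have h2 : fderiv ℝ f (x, t • y) (0, y) = (2 / t) • f (x, t • y) := by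
      have : ((0, y) : E × E) = t⁻¹ • (0, t • y) := by simp [smul_smul, ht0.ne']
      rw [this, map_smul, h t ht0, smul_smul]
      congr 1
      ring
    have h3 := ((hasDerivAt_pow 2 t).inv (by positivity)).smul h1
    convert! h3 using 1
    rw [h2, smul_smul, ← add_smul]
    have : ((t ^ 2)⁻¹ * (2 / t) + -(((2 : ℕ) : ℝ) * t ^ (2 - 1)) / (t ^ 2) ^ 2) = 0 := by
      push_cast
      field_simp
      ring
    exact (zero_smul ℝ _).symm.trans (congrArg (· • f (x, t • y)) this.symm)
  have h4 := (convex_Ioi (0 : ℝ)).is_const_of_fderivWithin_eq_zero (𝕜 := ℝ)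
    (f := fun t : ℝ => (t ^ 2)⁻¹ • f (x, t • y))
    (fun t ht => (key t ht).differentiableAt.differentiableWithinAt)
    (fun t ht => by
      rw [fderivWithin_of_isOpen isOpen_Ioi ht]
      ext
      simpa using (key t ht).deriv) hc (Set.mem_Ioi.2 one_pos)
  simp only [one_pow, inv_one, one_smul] at h4
  rw [← h4, smul_smul, mul_inv_cancel₀ (by positivity), one_smul]

/-- Differentiating `h(c y) = c² h(y)` twice in `c` at `c = 1`. This is what makes a definite
Hessian of `F²` exclude zeros of `F`. -/
theorem fderiv_fderiv_self_of_homogeneous {h : E → ℝ} {y : E} (hh : ContDiffAt ℝ 2 h y)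
    (hom : ∀ c : ℝ, 0 < c → ∀ v, h (c • v) = c ^ 2 * h v) :
    fderiv ℝ (fderiv ℝ h) y y y = 2 * h y := by
  have hray : HasDerivAt (fun c : ℝ => c • y) y 1 := by
    simpa using (hasDerivAt_id (1 : ℝ)).smul_const y
  have hd : DifferentiableAt ℝ (fderiv ℝ h) y :=
    (hh.fderiv_right (m := 1) (by norm_num)).differentiableAt (by simp)
  have h1 : HasDerivAt (fun c : ℝ => fderiv ℝ h (c • y) y) (fderiv ℝ (fderiv ℝ h) y y y) 1 := by
    have : HasFDerivAt (fderiv ℝ h) (fderiv ℝ (fderiv ℝ h) y) ((1 : ℝ) • y) := by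
      simpa using hd.hasFDerivAt
    simpa using (this.comp_hasDerivAt (x := (1 : ℝ)) (f := fun c : ℝ => c • y) hray).clm_apply
      (hasDerivAt_const (1 : ℝ) y)
  have h2 : HasDerivAt (fun c : ℝ => 2 * c * h y) (2 * h y) 1 := by
    simpa using (((hasDerivAt_id (1 : ℝ)).const_mul 2).mul_const (h y))
  refine h1.unique (h2.congr_of_eventuallyEq ?_)
  have h0 : ∀ᶠ v in 𝓝 y, DifferentiableAt ℝ h v :=
    (hh.eventually (by simp)).mono fun v hv => hv.differentiableAt (by simp)
  have h0' : ∀ᶠ c : ℝ in 𝓝 1, DifferentiableAt ℝ h (c • y) :=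
    hray.continuousAt.eventually (by simpa using h0)
  filter_upwards [h0', lt_mem_nhds one_pos] with c hc hc0
  have h3 : HasDerivAt (fun c : ℝ => h (c • y)) (fderiv ℝ h (c • y) y) c :=
    HasFDerivAt.comp_hasDerivAt (x := c) (f := fun c : ℝ => c • y) hc.hasFDerivAt
      (by simpa using (hasDerivAt_id c).smul_const y)
  have h4 : HasDerivAt (fun c : ℝ => c ^ 2 * h y) (2 * c * h y) c := by
    simpa using (hasDerivAt_pow 2 c).mul_const (h y)
  refine h3.unique (h4.congr_of_eventuallyEq ?_)
  filter_upwards [lt_mem_nhds hc0] with t ht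
  exact hom t ht y

/-- The derivative of Euler's identity `C g = g` in the direction `u`. -/
theorem fderiv_fderiv_vertical {g : E × E → ℝ} {z : E × E} (hg : ContDiffAt ℝ 2 g z)
    (he : ∀ᶠ z' in 𝓝 z, fderiv ℝ g z' (0, z'.2) = g z') (u : E × E) :
    fderiv ℝ (fderiv ℝ g) z u (0, z.2) + fderiv ℝ g z (0, u.2) = fderiv ℝ g z u := by
  have hd : DifferentiableAt ℝ (fderiv ℝ g) z :=
    (hg.fderiv_right (m := 1) (by norm_num)).differentiableAt (by simp)
  have h1 : HasFDerivAt (fun z' : E × E => ((0 : E), z'.2))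
      ((ContinuousLinearMap.inr ℝ E E).comp (ContinuousLinearMap.snd ℝ E E)) z :=
    ((ContinuousLinearMap.inr ℝ E E).comp (ContinuousLinearMap.snd ℝ E E)).hasFDerivAt
  have h2 := (hd.hasFDerivAt.clm_apply h1).fderiv
  rw [Filter.EventuallyEq.fderiv_eq (f := g) he] at h2
  have h3 := DFunLike.congr_fun h2 u
  simp at h3
  linarith

/-- This is `i_C dd_J g = 0`: by symmetry of the second derivative, the remaining term is the
differentiated Euler identity in a vertical direction, where the first derivatives cancel. -/
theorem ddJ_vertical {g : E × E → ℝ} {z : E × E} (hg : ContDiffAt ℝ 2 g z)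
    (he : ∀ᶠ z' in 𝓝 z, fderiv ℝ g z' (0, z'.2) = g z') (w : E × E) :
    ddJ g z (0, z.2) w = 0 := by
  have hs : IsSymmSndFDerivAt ℝ g z := hg.isSymmSndFDerivAt (by simp)
  have h1 := fderiv_fderiv_vertical hg he (0, w.1)
  rw [ddJ, hs.eq]
  have h2 : ((0, ((0, z.2) : E × E).1) : E × E) = 0 := rfl
  rw [h2, map_zero]
  linarith

theorem fderiv_energy {g : E × E → ℝ} {z : E × E} (hg : DifferentiableAt ℝ g z) :
    fderiv ℝ (fun z => g z ^ 2 / 2) z = g z • fderiv ℝ g z := by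
  have h := ((hg.hasFDerivAt.pow 2).const_mul (2⁻¹ : ℝ)).fderiv
  have h2 : (fun z => g z ^ 2 / 2) = fun z => 2⁻¹ * g z ^ 2 := by funext; ring
  rw [h2, h]
  ext u <;> simp <;> ring

/-- The Leibniz rule `dd_J (g²/2) = dg ∧ d_J g + g dd_J g`. -/
theorem ddJ_energy {g : E × E → ℝ} {z : E × E} (hg : ContDiffAt ℝ 2 g z) (u w : E × E) :
    ddJ (fun z => g z ^ 2 / 2) z u w =
      fderiv ℝ g z u * fderiv ℝ g z (0, w.1) - fderiv ℝ g z w * fderiv ℝ g z (0, u.1) +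
        g z * ddJ g z u w := by
  have hd : DifferentiableAt ℝ (fderiv ℝ g) z :=
    (hg.fderiv_right (m := 1) (by norm_num)).differentiableAt (by simp)
  have h1 : fderiv ℝ (fun z => g z ^ 2 / 2) =ᶠ[𝓝 z] fun z => g z • fderiv ℝ g z := by
    filter_upwards [hg.eventually (by simp)] with z' h
    exact fderiv_energy (h.differentiableAt (by simp))
  have h2 := ((hg.differentiableAt (by simp)).hasFDerivAt.smul hd.hasFDerivAt).fderiv
  have h3 := h1.fderiv_eq.trans h2
  rw [ddJ, h3, ddJ]
  simp
  ring

end Euler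

/-! ### Sprays in coordinates and their modification by multiples of `C`. -/

section Sprays
variable {E : Type*} [NormedAddCommGroup E] [NormedSpace ℝ E]
  {M : Type*} [TopologicalSpace M] [ChartedSpace E M]
  [IsManifold 𝓘(ℝ, E) ∞ M]
  {S : (p : TM E M) → TangentSpace 𝓘(ℝ, E).tangent p}

/-- The trivialization of `T(TM)` at a point is the differential of the chart there, so smoothness
of a section can be tested on its chart components. -/
theorem contMDiffAt_field_iff {x₀ : M} {q : TM E M} (hq : q.1 ∈ (chartAt E x₀).source) :
    ContMDiffAt 𝓘(ℝ, E).tangent 𝓘(ℝ, E).tangent.tangent ∞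
      (fun p => (⟨p, S p⟩ : TangentBundle 𝓘(ℝ, E).tangent (TM E M))) q ↔
    ContMDiffAt 𝓘(ℝ, E).tangent 𝓘(ℝ, E × E) ∞ (fun q' => dchart x₀ q' (S q')) q := by
  have hmem : q ∈ (trivializationAt (E × E) (TangentSpace 𝓘(ℝ, E).tangent)
      (⟨x₀, 0⟩ : TM E M)).baseSet := (TangentBundle.mem_chart_source_iff q ⟨x₀, 0⟩).2 hq
  refine (Bundle.Trivialization.contMDiffAt_section_iff
    (trivializationAt (E × E) (TangentSpace 𝓘(ℝ, E).tangent) (⟨x₀, 0⟩ : TM E M)) hmem).trans ?_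
  apply Filter.EventuallyEq.contMDiffAt_iff
  filter_upwards [eventually_proj_mem hq] with q' hq'
  have hmem' : q' ∈ (chartAt (ModelProd E E) (⟨x₀, 0⟩ : TM E M)).source :=
    (TangentBundle.mem_chart_source_iff q' ⟨x₀, 0⟩).2 hq'
  have h1 := TangentBundle.continuousLinearMapAt_trivializationAt (I := 𝓘(ℝ, E).tangent) hmem'
  have h2 := (trivializationAt (E × E) (TangentSpace 𝓘(ℝ, E).tangent)
    (⟨x₀, 0⟩ : TM E M)).coe_linearMapAt_of_mem (R := ℝ) (b := q') hmem'
  exact (congrFun h2 (S q')).symm.trans (DFunLike.congr_fun h1 (S q'))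

theorem contDiffOn_localField (hS : ContMDiffOn 𝓘(ℝ, E).tangent 𝓘(ℝ, E).tangent.tangent ∞
      (fun p => (⟨p, S p⟩ : TangentBundle 𝓘(ℝ, E).tangent (TM E M))) (slit E M)) (x₀ : M) :
    ContDiffOn ℝ ∞ (localField S x₀) (slitTarget E x₀) := by
  intro z hz
  have h1 := (contMDiffAt_field_iff (tchart_symm_proj_mem hz.1)).1
    (hS.contMDiffAt (isOpen_slit.mem_nhds (tchart_symm_mem_slit hz)))
  exact (ContMDiffAt.comp z h1 (contMDiffAt_tchart_symm hz.1)).contDiffAt.contDiffWithinAt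

theorem localField_liouville {x₀ : M} {z : E × E} (hz : z ∈ (tchart E x₀).target) :
    localField (liouville (E := E) (M := M)) x₀ z = (0, z.2) := by
  rw [localField, dchart_liouville (tchart_symm_proj_mem hz), (tchart E x₀).right_inv hz]

theorem inverse_dchartSymm {x₀ : M} {z : E × E} (hz : z ∈ (tchart E x₀).target) :
    (dchartSymm x₀ z).inverse = dchart x₀ ((tchart E x₀).symm z) :=
  ContinuousLinearMap.inverse_eq
    (ContinuousLinearMap.ext fun u => dchartSymm_dchart hz u)
    (ContinuousLinearMap.ext fun u => dchart_dchartSymm hz u)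

theorem dchart_mlieBracket (V W : (p : TM E M) → TangentSpace 𝓘(ℝ, E).tangent p) (p : TM E M) :
    dchart p.1 p (VectorField.mlieBracket 𝓘(ℝ, E).tangent V W p) =
      VectorField.lieBracket ℝ (localField V p.1) (localField W p.1) (tchart E p.1 p) := by
  have hs : p.1 ∈ (chartAt E p.1).source := mem_chart_source _ _
  have key : ∀ V : (p : TM E M) → TangentSpace 𝓘(ℝ, E).tangent p,
      VectorField.mpullbackWithin 𝓘(ℝ, E × E) 𝓘(ℝ, E).tangent (tchart E p.1).symm V
        (Set.range 𝓘(ℝ, E).tangent) =ᶠ[𝓝 (tchart E p.1 p)] localField V p.1 := by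
    intro V
    filter_upwards [(isOpen_tchart_target p.1).mem_nhds (tchart_mem_target hs)] with z hz
    rw [VectorField.mpullbackWithin_apply, ModelWithCorners.range_eq_univ, mfderivWithin_univ]
    exact DFunLike.congr_fun (inverse_dchartSymm hz) _
  have h1 : VectorField.mlieBracket 𝓘(ℝ, E).tangent V W p =
      (dchart p.1 p).inverse (VectorField.lieBracket ℝ (localField V p.1) (localField W p.1)
        (tchart E p.1 p)) := by
    rw [← (key V).lieBracket_vectorField_eq (key W), ← VectorField.mlieBracketWithin_univ,
      VectorField.mlieBracketWithin_apply, Set.preimage_univ, Set.univ_inter,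
      ModelWithCorners.range_eq_univ]
    exact congrArg (fun X : E × E → E × E => (dchart p.1 p).inverse (X (tchart E p.1 p)))
      VectorField.lieBracketWithin_univ
  rw [h1]
  exact DFunLike.congr_fun (isInvertible_mfderiv_extChartAt (I := 𝓘(ℝ, E).tangent)
    (mem_tchart_source.2 hs)).self_comp_inverse _

theorem lieBracket_vertical {s c : E × E → E × E} {z : E × E} (hc : c =ᶠ[𝓝 z] fun z => (0, z.2)) :
    VectorField.lieBracket ℝ c s z = fderiv ℝ s z (0, z.2) - (0, (s z).2) := by
  rw [hc.lieBracket_vectorField_eq (Filter.EventuallyEq.refl _ s), VectorField.lieBracket]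
  have h1 : HasFDerivAt (fun z' : E × E => ((0 : E), z'.2))
      ((ContinuousLinearMap.inr ℝ E E).comp (ContinuousLinearMap.snd ℝ E E)) z :=
    ((ContinuousLinearMap.inr ℝ E E).comp (ContinuousLinearMap.snd ℝ E E)).hasFDerivAt
  rw [h1.fderiv]
  simp

/-- Since `C` is `(0, y)` in the chart, the fibre part of `[C, S] = S` is Euler's equation of degree
two for the coefficients of `S`. -/
theorem bracket_liouville_eq_iff {p : TM E M} :
    VectorField.mlieBracket 𝓘(ℝ, E).tangent (liouville (E := E) (M := M)) S p = S p ↔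
      fderiv ℝ (localField S p.1) (tchart E p.1 p) (0, (tchart E p.1 p).2) -
        (0, (localField S p.1 (tchart E p.1 p)).2) = localField S p.1 (tchart E p.1 p) := by
  have hs : p.1 ∈ (chartAt E p.1).source := mem_chart_source _ _
  rw [← (injective_dchart hs).eq_iff, dchart_mlieBracket, lieBracket_vertical,
    ← localField_tchart hs]
  filter_upwards [(isOpen_tchart_target p.1).mem_nhds (tchart_mem_target hs)] with z hz
  exact localField_liouville hz

theorem vertEndo_eq_liouville_iff {x₀ : M} {q : TM E M} (hq : q.1 ∈ (chartAt E x₀).source) :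
    vertEndo q (S q) = liouville q ↔
      (localField S x₀ (tchart E x₀ q)).1 = (tchart E x₀ q).2 := by
  rw [← (injective_dchart hq).eq_iff, dchart_vertEndo hq, dchart_liouville hq,
    localField_tchart hq]
  simp

theorem IsSpray.localField_fst (hS : IsSpray S) {x₀ : M} {z : E × E} (hz : z ∈ slitTarget E x₀) :
    (localField S x₀ z).1 = z.2 := by
  have h := (vertEndo_eq_liouville_iff (tchart_symm_proj_mem hz.1)).1
    (hS.vertEndo_eq _ (tchart_symm_mem_slit hz))
  rwa [(tchart E x₀).right_inv hz.1] at h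

theorem tchart_smul {x₀ : M} {q : TM E M} (hq : q.1 ∈ (chartAt E x₀).source) (c : ℝ) :
    tchart E x₀ (⟨q.1, c • q.2⟩ : TM E M) = ((tchart E x₀ q).1, c • (tchart E x₀ q).2) := by
  rw [tchart_apply hq, tchart_apply (q := ⟨q.1, c • q.2⟩) hq]
  exact Prod.ext rfl (map_smul (chartDeriv E x₀ q.1) c q.2)

omit [IsManifold 𝓘(ℝ, E) ∞ M] in
theorem smul_mem_slit {q : TM E M} (hq : q ∈ slit E M) {c : ℝ} (hc : 0 < c) :
    (⟨q.1, c • q.2⟩ : TM E M) ∈ slit E M := smul_ne_zero hc.ne' hq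

theorem IsSpray.fderiv_localField_snd (hS : IsSpray S) {p : TM E M} (hp : p ∈ slit E M) :
    fderiv ℝ (fun z => (localField S p.1 z).2) (tchart E p.1 p) (0, (tchart E p.1 p).2) =
      (2 : ℝ) • (localField S p.1 (tchart E p.1 p)).2 := by
  have hz := tchart_mem_slitTarget (mem_chart_source _ _) hp
  have h := congrArg Prod.snd (bracket_liouville_eq_iff.1 (hS.bracket_eq p hp))
  have hd : DifferentiableAt ℝ (localField S p.1) (tchart E p.1 p) :=
    ((contDiffOn_localField hS.smooth p.1).contDiffAt
      ((isOpen_slitTarget p.1).mem_nhds hz)).differentiableAt (by simp)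
  rw [hd.hasFDerivAt.snd.fderiv, two_smul]
  simpa [sub_eq_iff_eq_add] using h

/-- The coefficients of a spray are positively homogeneous of degree two. -/
theorem IsSpray.localField_smul (hS : IsSpray S) {p : TM E M} (hp : p ∈ slit E M) {c : ℝ}
    (hc : 0 < c) :
    localField S p.1 ((tchart E p.1 p).1, c • (tchart E p.1 p).2) =
      (c • (tchart E p.1 p).2, c ^ 2 • (localField S p.1 (tchart E p.1 p)).2) := by
  have hs : p.1 ∈ (chartAt E p.1).source := mem_chart_source _ _
  have hmem : ∀ c : ℝ, 0 < c →
      ((tchart E p.1 p).1, c • (tchart E p.1 p).2) ∈ slitTarget E p.1 := fun c hc => by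
    rw [← tchart_smul hs]
    exact tchart_mem_slitTarget (x₀ := p.1) hs (smul_mem_slit hp hc)
  refine Prod.ext (hS.localField_fst (hmem c hc)) ?_
  refine homogeneous_two_of_fderiv_vertical (f := fun z => (localField S p.1 z).2)
    (fun c hc => ?_) (fun c hc => ?_) hc
  · exact (((contDiffOn_localField hS.smooth p.1).contDiffAt
      ((isOpen_slitTarget p.1).mem_nhds (hmem c hc))).differentiableAt (by simp)).snd
  · have h := hS.fderiv_localField_snd (smul_mem_slit hp hc)
    rwa [tchart_smul (x₀ := p.1) hs] at h

theorem localField_sub_smul_liouville (a : TM E M → ℝ) {x₀ : M} {z : E × E}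
    (hz : z ∈ (tchart E x₀).target) :
    localField (fun p => S p - a p • liouville p) x₀ z =
      localField S x₀ z - localFun a x₀ z • (0, z.2) := by
  have h := localField_liouville (E := E) hz
  rw [localField] at h
  rw [localField, map_sub, map_smul, h]
  rfl

/-- Subtracting a homogeneous multiple of the Liouville field from a spray yields a spray. -/
theorem IsSpray.sub_smul_liouville (hS : IsSpray S) {a : TM E M → ℝ}
    (ha : ContMDiffOn 𝓘(ℝ, E).tangent 𝓘(ℝ, ℝ) ∞ a (slit E M))
    (hom : ∀ p ∈ slit E M, ∀ c : ℝ, 0 < c → a ⟨p.1, c • p.2⟩ = c * a p) :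
    IsSpray (fun p => S p - a p • liouville p) where
  smooth := by
    intro q hq
    have hs : q.1 ∈ (chartAt E q.1).source := mem_chart_source _ _
    have h1 := (contMDiffAt_field_iff hs).1 (hS.smooth.contMDiffAt (isOpen_slit.mem_nhds hq))
    refine ((contMDiffAt_field_iff hs).2 ?_).contMDiffWithinAt
    have h2 : ContMDiffAt 𝓘(ℝ, E).tangent 𝓘(ℝ, E × E) ∞
        (fun q' : TM E M => (((0 : E), (tchart E q.1 q').2) : E × E)) q := by
      have h3 : ContDiff ℝ ∞ (fun z : E × E => ((0 : E), z.2)) := by fun_prop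
      exact h3.contMDiff.contMDiffAt.comp q (contMDiffAt_tchart hs)
    refine (h1.sub ((ha.contMDiffAt (isOpen_slit.mem_nhds hq)).smul h2)).congr_of_eventuallyEq ?_
    filter_upwards [eventually_proj_mem hs] with q' hq'
    rw [map_sub, map_smul, dchart_liouville hq']
    rfl
  vertEndo_eq p hp := by
    have hs : p.1 ∈ (chartAt E p.1).source := mem_chart_source _ _
    refine (vertEndo_eq_liouville_iff (S := fun p => S p - a p • liouville p) hs).2 ?_
    rw [localField_sub_smul_liouville _ (tchart_mem_target hs)]
    simp [hS.localField_fst (tchart_mem_slitTarget hs hp)]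
  bracket_eq p hp := by
    have hs : p.1 ∈ (chartAt E p.1).source := mem_chart_source _ _
    have hz := tchart_mem_slitTarget hs hp
    have h0 := bracket_liouville_eq_iff.1 (hS.bracket_eq p hp)
    rw [bracket_liouville_eq_iff, localField_sub_smul_liouville _ hz.1]
    have hd : DifferentiableAt ℝ (localField S p.1) (tchart E p.1 p) :=
      ((contDiffOn_localField hS.smooth p.1).contDiffAt
        ((isOpen_slitTarget p.1).mem_nhds hz)).differentiableAt (by simp)
    have hda : DifferentiableAt ℝ (localFun a p.1) (tchart E p.1 p) :=
      ((contDiffOn_localFun ha p.1).contDiffAt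
        ((isOpen_slitTarget p.1).mem_nhds hz)).differentiableAt (by simp)
    have he : localField (fun p => S p - a p • liouville p) p.1 =ᶠ[𝓝 (tchart E p.1 p)]
        fun z => localField S p.1 z - localFun a p.1 z • ((0, z.2) : E × E) := by
      filter_upwards [(isOpen_tchart_target p.1).mem_nhds hz.1] with z hz
      exact localField_sub_smul_liouville _ hz
    have h1 : HasFDerivAt (fun z' : E × E => ((0 : E), z'.2))
        ((ContinuousLinearMap.inr ℝ E E).comp (ContinuousLinearMap.snd ℝ E E)) (tchart E p.1 p) :=
      ((ContinuousLinearMap.inr ℝ E E).comp (ContinuousLinearMap.snd ℝ E E)).hasFDerivAt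
    -- Euler's identity `C(a) = a`, whence `[C, a C] = C(a) C = a C`; subtracting this from `[C, S]
    -- = S` gives the claim.
    have h2 := fderiv_vertical_of_homogeneous (k := 1) hda fun c hc => by
      rw [← tchart_smul hs, localFun_tchart (x₀ := p.1) (q := ⟨p.1, c • p.2⟩) hs,
        localFun_tchart hs, hom p hp c hc]
      simp
    have h3 : HasFDerivAt (fun z => localField S p.1 z - localFun a p.1 z • ((0, z.2) : E × E)) _ _ :=
      hd.hasFDerivAt.sub (hda.hasFDerivAt.smul h1)
    rw [he.fderiv_eq, h3.fderiv]
    simp only [Nat.cast_one, one_smul] at h2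
    generalize tchart E p.1 p = z at *
    refine Eq.trans ?_ (congrArg (· - localFun a p.1 z • ((0, z.2) : E × E)) h0)
    simp only [sub_apply, add_apply,
      smul_apply, ContinuousLinearMap.smulRight_apply, h2,
      ContinuousLinearMap.comp_apply, ContinuousLinearMap.inr_apply,
      ContinuousLinearMap.coe_snd']
    refine Prod.ext (by simp) ?_
    simp only [Prod.snd_sub, Prod.snd_add, Prod.smul_snd]
    abel

end Sprays

/-! ### Geodesics as solutions of a first-order system in a chart. -/

section Geodesics
variable {E : Type*} [NormedAddCommGroup E] [NormedSpace ℝ E]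
  {M : Type*} [TopologicalSpace M] [ChartedSpace E M]
  [IsManifold 𝓘(ℝ, E) ∞ M]
  {S S' : (p : TM E M) → TangentSpace 𝓘(ℝ, E).tangent p} {γ : ℝ → M} {I : Set ℝ}

/-- A solution of an autonomous equation with smooth right hand side is smooth. -/
theorem contDiffOn_of_hasDerivAt {V : Type*} [NormedAddCommGroup V] [NormedSpace ℝ V]
    {f : V → V} {U : Set V} {α : ℝ → V} {I : Set ℝ} (hI : IsOpen I) (hf : ContDiffOn ℝ ∞ f U)
    (hU : Set.MapsTo α I U) (h : ∀ t ∈ I, HasDerivAt α (f (α t)) t) : ContDiffOn ℝ ∞ α I := by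
  rw [contDiffOn_infty]
  intro n
  induction n with
  | zero => exact contDiffOn_zero.2 fun t ht => (h t ht).continuousAt.continuousWithinAt
  | succ n ih =>
    push_cast
    rw [contDiffOn_succ_iff_deriv_of_isOpen hI]
    refine ⟨fun t ht => (h t ht).differentiableAt.differentiableWithinAt, by simp, ?_⟩
    exact ((hf.of_le (by exact_mod_cast le_top)).comp ih hU).congr fun t ht => (h t ht).deriv

theorem contDiffAt_deriv {V : Type*} [NormedAddCommGroup V] [NormedSpace ℝ V] {f : ℝ → V} {t : ℝ}
    (hf : ContDiffAt ℝ ∞ f t) : ContDiffAt ℝ ∞ (deriv f) t :=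
  (hf.fderiv_right (m := ∞) (by simp)).clm_apply contDiffAt_const

theorem hasDerivAt_fst {V W : Type*} [NormedAddCommGroup V] [NormedSpace ℝ V]
    [NormedAddCommGroup W] [NormedSpace ℝ W] {f : ℝ → V × W} {f' : V × W} {t : ℝ}
    (hf : HasDerivAt f f' t) : HasDerivAt (fun t => (f t).1) f'.1 t := by
  simpa using (HasFDerivAt.fst hf.hasFDerivAt).hasDerivAt

theorem hasDerivAt_snd {V W : Type*} [NormedAddCommGroup V] [NormedSpace ℝ V]
    [NormedAddCommGroup W] [NormedSpace ℝ W] {f : ℝ → V × W} {f' : V × W} {t : ℝ}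
    (hf : HasDerivAt f f' t) : HasDerivAt (fun t => (f t).2) f'.2 t := by
  simpa using (HasFDerivAt.snd hf.hasFDerivAt).hasDerivAt

theorem tchart_velocity {x₀ : M} {t : ℝ} (ht : γ t ∈ (chartAt E x₀).source)
    (hγ : MDifferentiableAt 𝓘(ℝ, ℝ) 𝓘(ℝ, E) γ t) :
    tchart E x₀ (velocity E γ t) =
      (extChartAt 𝓘(ℝ, E) x₀ (γ t), deriv (fun t => extChartAt 𝓘(ℝ, E) x₀ (γ t)) t) := by
  rw [tchart_apply (q := velocity E γ t) ht]
  refine Prod.ext rfl ?_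
  have h := mfderiv_comp (I'' := 𝓘(ℝ, E)) t (mdifferentiableAt_extChartAt (I := 𝓘(ℝ, E)) ht) hγ
  rw [mfderiv_eq_fderiv] at h
  exact (DFunLike.congr_fun h (1 : ℝ)).symm

theorem contDiffAt_extChartAt_comp {x₀ : M} {t : ℝ} (ht : γ t ∈ (chartAt E x₀).source)
    (hγ : ContMDiffAt 𝓘(ℝ, ℝ) 𝓘(ℝ, E) ∞ γ t) :
    ContDiffAt ℝ ∞ (fun t => extChartAt 𝓘(ℝ, E) x₀ (γ t)) t :=
  ((contMDiffAt_extChartAt' ht).comp t hγ).contDiffAt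

theorem eventually_tchart_velocity {x₀ : M} {t : ℝ} (ht : γ t ∈ (chartAt E x₀).source)
    (hI : IsOpen I) (hγ : ContMDiffOn 𝓘(ℝ, ℝ) 𝓘(ℝ, E) ∞ γ I) (htI : t ∈ I) :
    ∀ᶠ t' in 𝓝 t, t' ∈ I ∧ γ t' ∈ (chartAt E x₀).source ∧ tchart E x₀ (velocity E γ t') =
      (extChartAt 𝓘(ℝ, E) x₀ (γ t'), deriv (fun t => extChartAt 𝓘(ℝ, E) x₀ (γ t)) t') := by
  filter_upwards [hI.mem_nhds htI, (hγ.contMDiffAt (hI.mem_nhds htI)).continuousAt.preimage_mem_nhds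
    ((chartAt E x₀).open_source.mem_nhds ht)] with t' h1 h2
  exact ⟨h1, h2, tchart_velocity h2
    ((hγ.contMDiffAt (hI.mem_nhds h1)).mdifferentiableAt (by simp))⟩

theorem contMDiffOn_velocity (hI : IsOpen I) (hγ : ContMDiffOn 𝓘(ℝ, ℝ) 𝓘(ℝ, E) ∞ γ I) :
    ContMDiffOn 𝓘(ℝ, ℝ) 𝓘(ℝ, E).tangent ∞ (velocity E γ) I := by
  intro t ht
  have hs : γ t ∈ (chartAt E (γ t)).source := mem_chart_source _ _
  have hx := contDiffAt_extChartAt_comp hs (hγ.contMDiffAt (hI.mem_nhds ht))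
  have h := eventually_tchart_velocity hs hI hγ ht
  have h1 : ContDiffAt ℝ ∞ (fun t' => (extChartAt 𝓘(ℝ, E) (γ t) (γ t'),
      deriv (fun t' => extChartAt 𝓘(ℝ, E) (γ t) (γ t')) t')) t := hx.prodMk (contDiffAt_deriv hx)
  refine ContMDiffAt.contMDiffWithinAt ?_
  refine (ContMDiffAt.comp t (I' := 𝓘(ℝ, E × E)) (g := (tchart E (γ t)).symm)
    (contMDiffAt_tchart_symm ?_) h1.contMDiffAt).congr_of_eventuallyEq ?_
  · rw [← h.self_of_nhds.2.2]
    exact tchart_mem_target (q := velocity E γ t) hs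
  · filter_upwards [h] with t' h'
    rw [Function.comp_apply, ← h'.2.2, tchart_symm_tchart (q := velocity E γ t') h'.2.1]

/-- Turns `γ'' = S ∘ γ'` into an ordinary differential equation in `E × E`; the converse holds
because the differential of the chart is injective. -/
theorem hasMFDerivAt_velocity_iff {x₀ : M} {t : ℝ} (ht : γ t ∈ (chartAt E x₀).source)
    (hI : IsOpen I) (hγ : ContMDiffOn 𝓘(ℝ, ℝ) 𝓘(ℝ, E) ∞ γ I) (htI : t ∈ I) :
    HasMFDerivAt 𝓘(ℝ, ℝ) 𝓘(ℝ, E).tangent (velocity E γ) t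
      ((1 : ℝ →L[ℝ] ℝ).smulRight (S (velocity E γ t))) ↔
    HasDerivAt (fun t => tchart E x₀ (velocity E γ t))
      (localField S x₀ (tchart E x₀ (velocity E γ t))) t := by
  have hΦ : MDifferentiableAt 𝓘(ℝ, E).tangent 𝓘(ℝ, E × E) (tchart E x₀) (velocity E γ t) :=
    (contMDiffAt_tchart (q := velocity E γ t) ht).mdifferentiableAt (by simp)
  have hv : MDifferentiableAt 𝓘(ℝ, ℝ) 𝓘(ℝ, E).tangent (velocity E γ) t :=
    ((contMDiffOn_velocity hI hγ).contMDiffAt (hI.mem_nhds htI)).mdifferentiableAt (by simp)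
  have h0 := mfderiv_comp t hΦ hv
  rw [mfderiv_eq_fderiv] at h0
  have hd : DifferentiableAt ℝ (tchart E x₀ ∘ velocity E γ) t :=
    mdifferentiableAt_iff_differentiableAt.1 (hΦ.comp t hv)
  have h1 : deriv (fun t => tchart E x₀ (velocity E γ t)) t = dchart x₀ (velocity E γ t)
      (mfderiv 𝓘(ℝ, ℝ) 𝓘(ℝ, E).tangent (velocity E γ) t (1 : ℝ)) := DFunLike.congr_fun h0 (1 : ℝ)
  rw [localField_tchart (q := velocity E γ t) ht]
  constructor
  · intro h
    have h2 : mfderiv 𝓘(ℝ, ℝ) 𝓘(ℝ, E).tangent (velocity E γ) t (1 : ℝ) = S (velocity E γ t) := by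
      rw [h.mfderiv]
      exact one_smul ℝ (S (velocity E γ t))
    rw [← h2, ← h1]
    exact hd.hasDerivAt
  · intro h
    have h2 : mfderiv 𝓘(ℝ, ℝ) 𝓘(ℝ, E).tangent (velocity E γ) t (1 : ℝ) = S (velocity E γ t) :=
      injective_dchart (q := velocity E γ t) ht (h1.symm.trans h.deriv)
    have h3 : mfderiv 𝓘(ℝ, ℝ) 𝓘(ℝ, E).tangent (velocity E γ) t =
        (1 : ℝ →L[ℝ] ℝ).smulRight (S (velocity E γ t)) := by
      refine ContinuousLinearMap.ext_ring ?_
      exact h2.trans (one_smul ℝ (S (velocity E γ t))).symm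
    rw [← h3]
    exact hv.hasMFDerivAt

theorem IsGeodesicOn.hasDerivAt_tchart (h : IsGeodesicOn S γ I) {x₀ : M} {t : ℝ}
    (ht : γ t ∈ (chartAt E x₀).source) (htI : t ∈ I) :
    HasDerivAt (fun t => tchart E x₀ (velocity E γ t))
      (localField S x₀ (tchart E x₀ (velocity E γ t))) t :=
  (hasMFDerivAt_velocity_iff ht h.isOpen h.smooth htI).1
    ((h.integral t htI).hasMFDerivAt (h.isOpen.mem_nhds htI))

omit [IsManifold 𝓘(ℝ, E) ∞ M] in
theorem velocity_comp {φ : ℝ → ℝ} {s : ℝ} (hφ : DifferentiableAt ℝ φ s)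
    (hγ : MDifferentiableAt 𝓘(ℝ, ℝ) 𝓘(ℝ, E) γ (φ s)) :
    velocity E (γ ∘ φ) s =
      ⟨(velocity E γ (φ s)).1, deriv φ s • (velocity E γ (φ s)).2⟩ := by
  have h := mfderiv_comp s hγ hφ.mdifferentiableAt
  have h1 : mfderiv 𝓘(ℝ, ℝ) 𝓘(ℝ, E) (γ ∘ φ) s (1 : ℝ) =
      mfderiv 𝓘(ℝ, ℝ) 𝓘(ℝ, E) γ (φ s) (deriv φ s : ℝ) := by
    rw [h, mfderiv_eq_fderiv]
    rfl
  have h2 : mfderiv 𝓘(ℝ, ℝ) 𝓘(ℝ, E) γ (φ s) (deriv φ s : ℝ) =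
      deriv φ s • mfderiv 𝓘(ℝ, ℝ) 𝓘(ℝ, E) γ (φ s) (1 : ℝ) := by
    have h3 := map_smul (mfderiv 𝓘(ℝ, ℝ) 𝓘(ℝ, E) γ (φ s)) (deriv φ s) (1 : ℝ)
    exact (congrArg (mfderiv 𝓘(ℝ, ℝ) 𝓘(ℝ, E) γ (φ s)) (mul_one (deriv φ s)).symm).trans h3
  exact congrArg (Bundle.TotalSpace.mk (γ (φ s))) (h1.trans h2)

/-- The acceleration of a reparametrized geodesic, in coordinates. -/
theorem IsGeodesicOn.hasDerivAt_tchart_comp (hS : IsSpray S) (h : IsGeodesicOn S γ I) {φ : ℝ → ℝ}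
    {s φ₂ : ℝ} (hs : φ s ∈ I) (hφ : ∀ᶠ s' in 𝓝 s, DifferentiableAt ℝ φ s')
    (hφ₂ : HasDerivAt (deriv φ) φ₂ s) {x₀ : M} (hx : γ (φ s) ∈ (chartAt E x₀).source) :
    HasDerivAt (fun s => tchart E x₀ (velocity E (γ ∘ φ) s))
      (deriv φ s • (tchart E x₀ (velocity E γ (φ s))).2,
        φ₂ • (tchart E x₀ (velocity E γ (φ s))).2 +
          deriv φ s ^ 2 • (localField S x₀ (tchart E x₀ (velocity E γ (φ s)))).2) s := by
  have hc : ContinuousAt φ s := hφ.self_of_nhds.continuousAt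
  have h1 := h.hasDerivAt_tchart hx hs
  have h2 := HasDerivAt.scomp s h1 hφ.self_of_nhds.hasDerivAt
  have hz : (localField S x₀ (tchart E x₀ (velocity E γ (φ s)))).1 =
      (tchart E x₀ (velocity E γ (φ s))).2 :=
    hS.localField_fst (tchart_mem_slitTarget (q := velocity E γ (φ s)) hx (h.regular _ hs))
  have h3 := (hasDerivAt_fst h2).prodMk (hφ₂.smul (hasDerivAt_snd h2))
  refine (h3.congr_of_eventuallyEq ?_).congr_deriv ?_
  · filter_upwards [hφ, hc.preimage_mem_nhds (h.isOpen.mem_nhds hs),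
      hc.eventually ((eventually_tchart_velocity hx h.isOpen h.smooth hs))] with s' h4 h5 h6
    rw [velocity_comp h4 ((h.smooth.contMDiffAt (h.isOpen.mem_nhds h5)).mdifferentiableAt
      (by simp)), tchart_smul (q := velocity E γ (φ s')) h6.2.1]
    rfl
  · simp [hz, smul_smul, pow_two, add_comm]

/-- Picard–Lindelöf for the local field of `S`. As `JS = C`, a solution `(x, y)` satisfies `x' = y`,
so it is the chart image of the velocity of its base curve. -/
theorem exists_isGeodesicOn [CompleteSpace E] (hS : IsSpray S) {p : TM E M} (hp : p ∈ slit E M) :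
    ∃ (γ : ℝ → M) (I : Set ℝ), IsGeodesicOn S γ I ∧ (0 : ℝ) ∈ I ∧ velocity E γ 0 = p := by
  have hs : p.1 ∈ (chartAt E p.1).source := mem_chart_source _ _
  have hz := tchart_mem_slitTarget hs hp
  have hσ := contDiffOn_localField hS.smooth p.1
  obtain ⟨α, hα0, ε, hε, hα⟩ :=
    ((hσ.contDiffAt ((isOpen_slitTarget p.1).mem_nhds hz)).of_le
      (by exact_mod_cast le_top : (1 : ℕ∞ω) ≤ ∞)
      ).exists_forall_mem_closedBall_exists_eq_forall_mem_Ioo_hasDerivAt₀ 0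
  have hc : ContinuousAt α 0 := (hα 0 ⟨by linarith, by linarith⟩).continuousAt
  have hev := hc.preimage_mem_nhds ((isOpen_slitTarget p.1).mem_nhds (by rwa [hα0]))
  obtain ⟨δ, hδ, hball⟩ := Metric.mem_nhds_iff.1 hev
  -- The bound `ε` is the existence time, and `δ` keeps the solution in the chart and off the zero
  -- section.
  set I : Set ℝ := Set.Ioo (-(min ε δ)) (min ε δ) with hI
  have hIo : IsOpen I := isOpen_Ioo
  have hI1 : ∀ t ∈ I, HasDerivAt α (localField S p.1 (α t)) t := fun t ht =>
    hα t ⟨by linarith [ht.1, min_le_left ε δ], by linarith [ht.2, min_le_left ε δ]⟩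
  have hI2 : ∀ t ∈ I, α t ∈ slitTarget E p.1 := fun t ht => hball <| by
    rw [Metric.mem_ball, Real.dist_eq, sub_zero, abs_lt]
    exact ⟨by linarith [ht.1, min_le_right ε δ], by linarith [ht.2, min_le_right ε δ]⟩
  have h0 : (0 : ℝ) ∈ I := ⟨neg_lt_zero.2 (lt_min hε hδ), lt_min hε hδ⟩
  have hαs : ContDiffOn ℝ ∞ α I := contDiffOn_of_hasDerivAt hIo hσ hI2 hI1
  have htgt : ∀ t ∈ I, (α t).1 ∈ (extChartAt 𝓘(ℝ, E) p.1).target := fun t ht => by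
    have := (hI2 t ht).1
    rw [tchart_target] at this
    exact this.1
  let γ : ℝ → M := fun t => (extChartAt 𝓘(ℝ, E) p.1).symm (α t).1
  have hγ : ContMDiffOn 𝓘(ℝ, ℝ) 𝓘(ℝ, E) ∞ γ I :=
    (contMDiffOn_extChartAt_symm (I := 𝓘(ℝ, E)) (n := ∞) p.1).comp
      (contDiff_fst.comp_contDiffOn hαs).contMDiffOn htgt
  have hγs : ∀ t ∈ I, γ t ∈ (chartAt E p.1).source := fun t ht => by
    have := (extChartAt 𝓘(ℝ, E) p.1).map_target (htgt t ht)
    rwa [extChartAt_source] at this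
  have hv : ∀ t ∈ I, tchart E p.1 (velocity E γ t) = α t := fun t ht => by
    have h1 : ∀ t ∈ I, extChartAt 𝓘(ℝ, E) p.1 (γ t) = (α t).1 := fun t ht =>
      (extChartAt 𝓘(ℝ, E) p.1).right_inv (htgt t ht)
    rw [tchart_velocity (hγs t ht)
      ((hγ.contMDiffAt (hIo.mem_nhds ht)).mdifferentiableAt (by simp)), h1 t ht]
    refine Prod.ext rfl ?_
    have h2 : (fun t => extChartAt 𝓘(ℝ, E) p.1 (γ t)) =ᶠ[𝓝 t] fun t => (α t).1 := by
      filter_upwards [hIo.mem_nhds ht] with t' ht' using h1 t' ht'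
    exact h2.deriv_eq.trans ((hasDerivAt_fst (hI1 t ht)).deriv.trans (hS.localField_fst (hI2 t ht)))
  refine ⟨γ, I, ⟨hIo, Set.ordConnected_Ioo, hγ, fun t ht => ?_, fun t ht => ?_⟩, h0, ?_⟩
  · rw [← tchart_symm_tchart (q := velocity E γ t) (hγs t ht), hv t ht]
    exact tchart_symm_mem_slit (hI2 t ht)
  · refine HasMFDerivAt.hasMFDerivWithinAt ?_
    rw [hasMFDerivAt_velocity_iff (hγs t ht) hIo hγ ht, hv t ht]
    refine (hI1 t ht).congr_of_eventuallyEq ?_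
    filter_upwards [hIo.mem_nhds ht] with t' ht' using hv t' ht'
  · rw [← tchart_symm_tchart (q := velocity E γ 0) (hγs 0 h0), hv 0 h0, hα0, tchart_symm_tchart hs]

/-- If the geodesics of `S` are, up to parametrization, geodesics of `S'`, then `S'` differs from
`S` by a multiple of the Liouville field. -/
theorem GeodesicsReparametrizeTo.exists_eq_sub_smul_liouville [CompleteSpace E] (hS : IsSpray S)
    (hS' : IsSpray S') (h : GeodesicsReparametrizeTo S S') {p : TM E M} (hp : p ∈ slit E M) :
    ∃ a : ℝ, S' p = S p - a • liouville p := by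
  have hs : p.1 ∈ (chartAt E p.1).source := mem_chart_source _ _
  obtain ⟨γ, I, hγ, h0, rfl⟩ := exists_isGeodesicOn hS hp
  obtain ⟨φ, K, hK, -, hφ, hpos, himg, hγφ⟩ := h γ I hγ
  obtain ⟨s, hsK, hs0⟩ : (0 : ℝ) ∈ φ '' K := himg ▸ h0
  have hφs : ContDiffAt ℝ ∞ φ s := hφ.contDiffAt (hK.mem_nhds hsK)
  have hd : ∀ᶠ s' in 𝓝 s, DifferentiableAt ℝ φ s' := by
    filter_upwards [hK.mem_nhds hsK] with s' h'
    exact (hφ.contDiffAt (hK.mem_nhds h')).differentiableAt (by simp)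
  have hd2 : DifferentiableAt ℝ (deriv φ) s :=
    (contDiffAt_deriv hφs).differentiableAt (by simp)
  have h1 := hγ.hasDerivAt_tchart_comp hS (s := s) (x₀ := γ 0) (by rwa [hs0]) hd hd2.hasDerivAt
    (by rw [hs0]; exact hs)
  have h2 := hγφ.hasDerivAt_tchart (x₀ := γ 0) (by rw [Function.comp_apply, hs0]; exact hs) hsK
  have h3 := h2.unique h1
  rw [velocity_comp hd.self_of_nhds (by
    rw [hs0]; exact (hγ.smooth.contMDiffAt (hγ.isOpen.mem_nhds h0)).mdifferentiableAt (by simp)),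
    hs0] at h3
  have h3' := tchart_smul (x₀ := γ 0) (q := velocity E γ 0) hs (deriv φ s)
  rw [h3'] at h3
  have h4 := hS'.localField_smul hp (hpos s hsK)
  have h5 := congrArg Prod.snd (h4.symm.trans h3)
  have hc : deriv φ s ≠ 0 := (hpos s hsK).ne'
  -- The equality `h5` reads `φ'² s'(y) = φ'' y + φ'² s(y)`; dividing by `φ'²` determines the factor
  -- of `C`.
  refine ⟨-(deriv (deriv φ) s / deriv φ s ^ 2), injective_dchart hs ?_⟩
  have hz := tchart_mem_slitTarget hs hp
  rw [map_sub, map_smul, dchart_liouville hs, ← localField_tchart hs, ← localField_tchart hs]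
  refine Prod.ext ?_ ?_
  · simp [hS.localField_fst hz, hS'.localField_fst hz]
  · have h6 := congrArg ((deriv φ s ^ 2)⁻¹ • ·) h5
    simp only [smul_add, smul_smul] at h6
    rw [inv_mul_cancel₀ (pow_ne_zero 2 hc), one_smul, one_smul] at h6
    refine h6.trans ?_
    simp only [neg_smul, sub_neg_eq_add]
    rw [add_comm, div_eq_inv_mul]
    rfl

end Geodesics

/-! ### The parameter change realizing `S ↦ S - a C`. -/

section Reparametrization

theorem exists_hasDerivAt_of_continuousOn {f : ℝ → ℝ} {I : Set ℝ} (hI : IsOpen I)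
    (hI' : I.OrdConnected) (hf : ContinuousOn f I) : ∃ F : ℝ → ℝ, ∀ t ∈ I, HasDerivAt F (f t) t := by
  rcases I.eq_empty_or_nonempty with rfl | ⟨t₀, h₀⟩
  · exact ⟨f, by simp⟩
  · refine ⟨fun t => ∫ x in t₀..t, f x, fun t ht => ?_⟩
    exact intervalIntegral.integral_hasDerivAt_right
      (hf.mono (hI'.uIcc_subset h₀ ht)).intervalIntegrable
      (hf.stronglyMeasurableAtFilter hI t ht) (hf.continuousAt (hI.mem_nhds ht))

theorem contDiffOn_antiderivative {F f : ℝ → ℝ} {I : Set ℝ} (hI : IsOpen I)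
    (hf : ContDiffOn ℝ ∞ f I) (h : ∀ t ∈ I, HasDerivAt F (f t) t) : ContDiffOn ℝ ∞ F I := by
  rw [contDiffOn_infty_iff_derivWithin hI.uniqueDiffOn]
  refine ⟨fun t ht => (h t ht).differentiableAt.differentiableWithinAt, hf.congr fun t ht => ?_⟩
  rw [derivWithin_of_isOpen hI ht, (h t ht).deriv]

/-- The parameter change solving `φ'' = - b(φ) φ'²`. -/
theorem exists_parameter_change {b : ℝ → ℝ} {I : Set ℝ} (hI : IsOpen I) (hI' : I.OrdConnected)
    (hb : ContDiffOn ℝ ∞ b I) :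
    ∃ (φ : ℝ → ℝ) (K : Set ℝ), IsOpen K ∧ K.OrdConnected ∧ ContDiffOn ℝ ∞ φ K ∧
      (∀ s ∈ K, 0 < deriv φ s) ∧ φ '' K = I ∧
      ∀ s ∈ K, HasDerivAt (deriv φ) (-b (φ s) * deriv φ s ^ 2) s := by
  -- Take `B' = b`, `ψ' = exp B` and `φ = ψ⁻¹`. Then `φ' = exp (-B ∘ φ)`, and differentiating once
  -- more yields the equation.
  obtain ⟨B, hB⟩ := exists_hasDerivAt_of_continuousOn hI hI' hb.continuousOn
  have hBs := contDiffOn_antiderivative hI hb hB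
  have hexp : ContDiffOn ℝ ∞ (fun t => Real.exp (B t)) I := hBs.exp
  obtain ⟨ψ, hψ⟩ := exists_hasDerivAt_of_continuousOn hI hI' hexp.continuousOn
  have hψs := contDiffOn_antiderivative hI hexp hψ
  have hmono : StrictMonoOn ψ I := by
    refine strictMonoOn_of_deriv_pos hI'.convex hψs.continuousOn fun t ht => ?_
    rw [hI.interior_eq] at ht
    rw [(hψ t ht).deriv]
    exact Real.exp_pos _
  -- The inverse function theorem: this gives both that `ψ '' I` is open and that `φ` is continuous.
  have hmap : ∀ t ∈ I, Filter.map ψ (𝓝 t) = 𝓝 (ψ t) := fun t ht => by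
    refine ((hψs.contDiffAt (hI.mem_nhds ht)).hasStrictDerivAt' (hψ t ht)
      (by simp)).map_nhds_eq (Real.exp_pos _).ne'
  have hK : IsOpen (ψ '' I) := by
    rw [isOpen_iff_mem_nhds]
    rintro _ ⟨t, ht, rfl⟩
    rw [← hmap t ht]
    exact Filter.image_mem_map (hI.mem_nhds ht)
  set φ := Function.invFunOn ψ I with hφdef
  have hleft : ∀ t ∈ I, φ (ψ t) = t := fun t ht => hmono.injOn.leftInvOn_invFunOn ht
  have hder : ∀ s ∈ ψ '' I, HasDerivAt φ (Real.exp (-B (φ s))) s := by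
    rintro _ ⟨t, ht, rfl⟩
    have hcont : ContinuousAt φ (ψ t) := by
      rw [ContinuousAt, hleft t ht, ← hmap t ht, Filter.tendsto_map'_iff]
      refine Filter.tendsto_id.congr' ?_
      filter_upwards [hI.mem_nhds ht] with t' ht'
      exact (hleft t' ht').symm
    rw [hleft t ht, Real.exp_neg]
    refine HasDerivAt.of_local_left_inverse (f := ψ) hcont ?_ (Real.exp_pos _).ne' ?_
    · rw [hleft t ht]
      exact hψ t ht
    · filter_upwards [hK.mem_nhds ⟨t, ht, rfl⟩]
      rintro _ ⟨t', ht', rfl⟩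
      rw [hleft t' ht']
  have hmaps : Set.MapsTo φ (ψ '' I) I := by
    rintro _ ⟨t, ht, rfl⟩
    rwa [hleft t ht]
  refine ⟨φ, ψ '' I, hK, (hI'.isPreconnected.image ψ hψs.continuousOn).ordConnected,
    contDiffOn_of_hasDerivAt hK (hBs.neg.exp) hmaps hder, fun s hs => ?_, ?_, fun s hs => ?_⟩
  · rw [(hder s hs).deriv]
    exact Real.exp_pos _
  · refine Set.Subset.antisymm hmaps.image_subset fun t ht => ⟨ψ t, ⟨t, ht, rfl⟩, hleft t ht⟩
  · have h1 : deriv φ =ᶠ[𝓝 s] fun s => Real.exp (-B (φ s)) := by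
      filter_upwards [hK.mem_nhds hs] with s' hs' using (hder s' hs').deriv
    have h2 : HasDerivAt (fun s => Real.exp (-B (φ s)))
        (Real.exp (-B (φ s)) * -(b (φ s) * Real.exp (-B (φ s)))) s :=
      (((hB _ (hmaps hs)).comp s (hder s hs)).neg).exp
    refine (h2.congr_of_eventuallyEq h1).congr_deriv ?_
    rw [(hder s hs).deriv]
    ring

variable {E : Type*} [NormedAddCommGroup E] [NormedSpace ℝ E]
  {M : Type*} [TopologicalSpace M] [ChartedSpace E M]
  [IsManifold 𝓘(ℝ, E) ∞ M]
  {S : (p : TM E M) → TangentSpace 𝓘(ℝ, E).tangent p}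

/-- Geodesics of `S` become geodesics of `S - a C` after reparametrization. -/
theorem geodesicsReparametrizeTo_sub_smul_liouville (hS : IsSpray S) {a : TM E M → ℝ}
    (ha : ContMDiffOn 𝓘(ℝ, E).tangent 𝓘(ℝ, ℝ) ∞ a (slit E M))
    (hom : ∀ p ∈ slit E M, ∀ c : ℝ, 0 < c → a ⟨p.1, c • p.2⟩ = c * a p) :
    GeodesicsReparametrizeTo S (fun p => S p - a p • liouville p) := by
  intro γ I hγ
  have hb : ContDiffOn ℝ ∞ (fun t => a (velocity E γ t)) I :=
    (ha.comp (contMDiffOn_velocity hγ.isOpen hγ.smooth) hγ.regular).contDiffOn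
  obtain ⟨φ, K, hK, hK', hφ, hpos, himg, hφ₂⟩ :=
    exists_parameter_change hγ.isOpen hγ.ordConnected hb
  have hmaps : ∀ s ∈ K, φ s ∈ I := fun s hs => himg ▸ Set.mem_image_of_mem φ hs
  have hd : ∀ s ∈ K, DifferentiableAt ℝ φ s := fun s hs =>
    (hφ.contDiffAt (hK.mem_nhds hs)).differentiableAt (by simp)
  have hvel : ∀ s ∈ K, velocity E (γ ∘ φ) s =
      ⟨(velocity E γ (φ s)).1, deriv φ s • (velocity E γ (φ s)).2⟩ := fun s hs =>
    velocity_comp (hd s hs) ((hγ.smooth.contMDiffAt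
      (hγ.isOpen.mem_nhds (hmaps s hs))).mdifferentiableAt (by simp))
  have hsm : ContMDiffOn 𝓘(ℝ, ℝ) 𝓘(ℝ, E) ∞ (γ ∘ φ) K := hγ.smooth.comp hφ.contMDiffOn hmaps
  refine ⟨φ, K, hK, hK', hφ, hpos, himg, hK, hK', hsm, fun s hs => ?_, fun s hs => ?_⟩
  · rw [hvel s hs]
    exact smul_mem_slit (hγ.regular _ (hmaps s hs)) (hpos s hs)
  · have hx : γ (φ s) ∈ (chartAt E (γ (φ s))).source := mem_chart_source _ _
    refine HasMFDerivAt.hasMFDerivWithinAt ?_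
    refine (hasMFDerivAt_velocity_iff (S := fun p => S p - a p • liouville p)
      (γ := γ ∘ φ) (x₀ := γ (φ s)) hx hK hsm hs).2 ?_
    have hp := hγ.regular _ (hmaps s hs)
    have h1 := hγ.hasDerivAt_tchart_comp hS (s := s) (x₀ := γ (φ s)) (hmaps s hs)
      ((hK.eventually_mem hs).mono hd) (hφ₂ s hs) hx
    refine h1.congr_deriv ?_
    have h2 : tchart E (γ (φ s)) (velocity E (γ ∘ φ) s) ∈ (tchart E (γ (φ s))).target :=
      tchart_mem_target (q := velocity E (γ ∘ φ) s) hx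
    have h3 := hS.localField_smul hp (hpos s hs)
    have h4 := tchart_smul (x₀ := γ (φ s)) (q := velocity E γ (φ s)) hx (deriv φ s)
    rw [localField_sub_smul_liouville _ h2,
      localFun_tchart (q := velocity E (γ ∘ φ) s) hx, hvel s hs, hom _ hp _ (hpos s hs), h4]
    refine Eq.trans ?_ (congrArg (· - _) h3.symm)
    refine Prod.ext (by simp; rfl) ?_
    simp only [Prod.snd_sub, Prod.smul_snd, smul_smul]
    -- At `φ' y` the factor `a` and the field `C` each contribute one `φ'`, so the term `-a C` there
    -- is exactly `φ'' y`.
    have h5 : deriv φ s * a (velocity E γ (φ s)) * deriv φ s =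
      -(-a (velocity E γ (φ s)) * deriv φ s ^ 2) := by ring
    rw [h5, neg_smul, sub_neg_eq_add, add_comm]
    rfl

end Reparametrization

/-! ### Finsler functions, the Euler-Lagrange form and the projective factor. -/

section Finsler
variable {E : Type*} [NormedAddCommGroup E] [NormedSpace ℝ E]
  {M : Type*} [TopologicalSpace M] [ChartedSpace E M]
  [IsManifold 𝓘(ℝ, E) ∞ M]
  {S : (p : TM E M) → TangentSpace 𝓘(ℝ, E).tangent p} {F : TM E M → ℝ}

theorem tchart_symm_smul {x₀ : M} {z : E × E} (hz : z ∈ (tchart E x₀).target) (c : ℝ) :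
    (tchart E x₀).symm (z.1, c • z.2) =
      ⟨((tchart E x₀).symm z).1, c • ((tchart E x₀).symm z).2⟩ := by
  have hq := tchart_symm_proj_mem hz
  have h1 := tchart_symm_tchart (x₀ := x₀)
    (q := ⟨((tchart E x₀).symm z).1, c • ((tchart E x₀).symm z).2⟩) hq
  rw [tchart_smul hq, (tchart E x₀).right_inv hz] at h1
  exact h1

theorem IsOneHomogeneous.localFun_smul (hF : IsOneHomogeneous F) {x₀ : M} {z : E × E}
    (hz : z ∈ (tchart E x₀).target) {c : ℝ} (hc : 0 < c) :
    localFun F x₀ (z.1, c • z.2) = c * localFun F x₀ z := by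
  rw [localFun, tchart_symm_smul hz, hF _ c hc]
  rfl

theorem contDiffAt_localFun_of_slit
    (hs : ContMDiffOn 𝓘(ℝ, E).tangent 𝓘(ℝ, ℝ) ∞ F (slit E M)) {x₀ : M} {z : E × E}
    (hz : z ∈ slitTarget E x₀) : ContDiffAt ℝ ∞ (localFun F x₀) z :=
  (contDiffOn_localFun hs x₀).contDiffAt ((isOpen_slitTarget x₀).mem_nhds hz)

/-- Euler's identity in coordinates. -/
theorem IsOneHomogeneous.fderiv_localFun (hF : IsOneHomogeneous F)
    (hs : ContMDiffOn 𝓘(ℝ, E).tangent 𝓘(ℝ, ℝ) ∞ F (slit E M)) {x₀ : M} {z : E × E}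
    (hz : z ∈ slitTarget E x₀) :
    fderiv ℝ (localFun F x₀) z (0, z.2) = localFun F x₀ z := by
  have h := fderiv_vertical_of_homogeneous (k := 1)
    ((contDiffAt_localFun_of_slit hs hz).differentiableAt (by simp))
    fun c hc => by rw [hF.localFun_smul hz.1 hc, pow_one, smul_eq_mul]
  simpa using h

/-- Differentiates `F(x, c y) = c F(x, y)` in `(x, y)` with `c` fixed. -/
theorem IsOneHomogeneous.fderiv_localFun_smul (hF : IsOneHomogeneous F)
    (hs : ContMDiffOn 𝓘(ℝ, E).tangent 𝓘(ℝ, ℝ) ∞ F (slit E M)) {x₀ : M} {z : E × E}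
    (hz : z ∈ slitTarget E x₀) {c : ℝ} (hc : 0 < c) (u v : E) :
    fderiv ℝ (localFun F x₀) (z.1, c • z.2) (u, c • v) =
      c * fderiv ℝ (localFun F x₀) z (u, v) := by
  have hz' : (z.1, c • z.2) ∈ slitTarget E x₀ := by
    refine ⟨?_, smul_ne_zero hc.ne' hz.2⟩
    have h := hz.1
    rw [tchart_target] at h ⊢
    exact ⟨h.1, trivial⟩
  let L : E × E →L[ℝ] E × E :=
    (ContinuousLinearMap.fst ℝ E E).prod (c • ContinuousLinearMap.snd ℝ E E)
  have h1 : HasFDerivAt (fun z : E × E => localFun F x₀ (L z))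
      ((fderiv ℝ (localFun F x₀) (z.1, c • z.2)).comp L) z :=
    HasFDerivAt.comp z (f := L) (g := localFun F x₀)
      ((contDiffAt_localFun_of_slit hs hz').differentiableAt (by simp)).hasFDerivAt L.hasFDerivAt
  have h2 : HasFDerivAt (fun z : E × E => c * localFun F x₀ z)
      (c • fderiv ℝ (localFun F x₀) z) z :=
    (((contDiffAt_localFun_of_slit hs hz).differentiableAt (by simp)).hasFDerivAt).const_mul c
  have h3 := h1.unique (h2.congr_of_eventuallyEq (by
    filter_upwards [(isOpen_tchart_target x₀).mem_nhds hz.1] with z' hz'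
    exact hF.localFun_smul hz' hc))
  exact DFunLike.congr_fun h3 (u, v)

theorem two_le_infty : (2 : ℕ∞ω) ≤ ∞ := WithTop.coe_le_coe.2 le_top

theorem contMDiffOn_energy (hs : ContMDiffOn 𝓘(ℝ, E).tangent 𝓘(ℝ, ℝ) ∞ F (slit E M)) :
    ContMDiffOn 𝓘(ℝ, E).tangent 𝓘(ℝ, ℝ) ∞ (energy F) (slit E M) := by
  have h : ContDiff ℝ ∞ (fun x : ℝ => x ^ 2 / 2) := by fun_prop
  exact h.contMDiff.comp_contMDiffOn hs

theorem dFun_energy_liouville (hF : IsOneHomogeneous F)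
    (hs : ContMDiffOn 𝓘(ℝ, E).tangent 𝓘(ℝ, ℝ) ∞ F (slit E M)) {q : TM E M} (hq : q ∈ slit E M) :
    dFun (energy F) q (liouville q) = 2 * energy F q := by
  have hx : q.1 ∈ (chartAt E q.1).source := mem_chart_source _ _
  have hz := tchart_mem_slitTarget hx hq
  rw [dFun_eq hx ((contMDiffOn_energy hs).contMDiffAt (isOpen_slit.mem_nhds hq)),
    dchart_liouville hx]
  change fderiv ℝ (fun z => localFun F q.1 z ^ 2 / 2) _ _ = _
  rw [fderiv_energy ((contDiffAt_localFun_of_slit hs hz).differentiableAt (by simp)),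
    smul_apply, hF.fderiv_localFun hs hz, localFun_tchart hx, energy]
  simp only [smul_eq_mul]
  ring

/-- The formula `ω_E = S(F) d_J F + F i_S dd_J F`. By `JS = C` and Euler, `d_J F (S) = F`, so the
term `-F dF` from `dF ∧ d_J F` cancels `d(C E) - dE = dE = F dF`. -/
theorem eulerLagrangeForm_energy (hF : IsOneHomogeneous F)
    (hs : ContMDiffOn 𝓘(ℝ, E).tangent 𝓘(ℝ, ℝ) ∞ F (slit E M)) {p : TM E M} (hp : p ∈ slit E M)
    (hS : (dchart p.1 p (S p)).1 = (tchart E p.1 p).2) (w : TangentSpace 𝓘(ℝ, E).tangent p) :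
    eulerLagrangeForm S (energy F) p w =
      fderiv ℝ (localFun F p.1) (tchart E p.1 p) (dchart p.1 p (S p)) *
          fderiv ℝ (localFun F p.1) (tchart E p.1 p) (0, (dchart p.1 p w).1) +
        F p * ddJ (localFun F p.1) (tchart E p.1 p) (dchart p.1 p (S p)) (dchart p.1 p w) := by
  have hx : p.1 ∈ (chartAt E p.1).source := mem_chart_source _ _
  have hz := tchart_mem_slitTarget hx hp
  have hE := contMDiffOn_energy hs
  have hEp := hE.contMDiffAt (isOpen_slit.mem_nhds hp)
  have hg := contDiffAt_localFun_of_slit hs hz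
  have h1 : dFun (fun q => dFun (energy F) q (liouville q)) p w = 2 * dFun (energy F) p w := by
    have h2 : (fun q => dFun (energy F) q (liouville q)) =ᶠ[𝓝 p] fun q => 2 * energy F q := by
      filter_upwards [isOpen_slit.mem_nhds hp] with q hq using dFun_energy_liouville hF hs hq
    have h3 : dFun (fun q => dFun (energy F) q (liouville q)) p =
        dFun (fun q => 2 * energy F q) p :=
      h2.mfderiv_eq (I := 𝓘(ℝ, E).tangent) (I' := 𝓘(ℝ, ℝ))
    have h4 : ContDiff ℝ ∞ (fun x : ℝ => 2 * x) := by fun_prop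
    have h6 : ContMDiffAt 𝓘(ℝ, E).tangent 𝓘(ℝ, ℝ) ∞ (fun q => 2 * energy F q) p :=
      h4.contMDiff.contMDiffAt.comp p hEp
    rw [h3, dFun_eq hx h6, dFun_eq hx hEp]
    have h5 : HasFDerivAt (localFun (fun q => 2 * energy F q) p.1) _ (tchart E p.1 p) :=
      ((contDiffAt_localFun_of_slit hE hz).differentiableAt (by simp)).hasFDerivAt.const_mul 2
    rw [h5.fderiv]
    rfl
  rw [eulerLagrangeForm, h1, dOneForm_dJ hE hp, dFun_eq hx hEp]
  change ddJ (fun z => localFun F p.1 z ^ 2 / 2) _ _ _ +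
    2 * fderiv ℝ (fun z => localFun F p.1 z ^ 2 / 2) _ _ -
      fderiv ℝ (fun z => localFun F p.1 z ^ 2 / 2) _ _ = _
  rw [ddJ_energy (hg.of_le two_le_infty), hS, hF.fderiv_localFun hs hz,
    fderiv_energy (hg.differentiableAt (by simp)), smul_apply,
    localFun_tchart hx, smul_eq_mul]
  ring

theorem ddJ_sub_smul_vertical (hF : IsOneHomogeneous F)
    (hs : ContMDiffOn 𝓘(ℝ, E).tangent 𝓘(ℝ, ℝ) ∞ F (slit E M)) {x₀ : M} {z : E × E}
    (hz : z ∈ slitTarget E x₀) (u w : E × E) (a : ℝ) :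
    ddJ (localFun F x₀) z (u - a • (0, z.2)) w = ddJ (localFun F x₀) z u w := by
  have h1 : ddJ (localFun F x₀) z (u - a • (0, z.2)) w =
      ddJ (localFun F x₀) z u w - a * ddJ (localFun F x₀) z (0, z.2) w := by
    have h2 : ((0, (u - a • ((0, z.2) : E × E)).1) : E × E) =
        (0, u.1) - a • (0, ((0, z.2) : E × E).1) := by simp
    simp only [ddJ]
    rw [h2]
    simp only [map_sub, map_smul, sub_apply, smul_apply,
      smul_eq_mul]
    ring
  rw [h1, ddJ_vertical ((contDiffAt_localFun_of_slit hs hz).of_le two_le_infty),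
    mul_zero, sub_zero]
  filter_upwards [(isOpen_slitTarget x₀).mem_nhds hz] with z' hz'
  exact hF.fderiv_localFun hs hz'

theorem fderiv_fderiv_half (h : E → ℝ) (y u w : E) :
    fderiv ℝ (fderiv ℝ (fun y => h y / 2)) y u w = 2⁻¹ * fderiv ℝ (fderiv ℝ h) y u w := by
  have h1 : (fun y => h y / 2) = (2⁻¹ : ℝ) • h := by
    funext y
    simp only [Pi.smul_apply, smul_eq_mul]
    ring
  have h2 := congrFun (fderiv_const_smul_field (𝕜 := ℝ) (2⁻¹ : ℝ) (f := fderiv ℝ h)) y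
  rw [h1, fderiv_const_smul_field]
  exact congrArg (fun L : E →L[ℝ] E →L[ℝ] ℝ => L u w) h2

omit [IsManifold 𝓘(ℝ, E) ∞ M] in
theorem fibreHessian_energy (p : TM E M) (u w : E) :
    fibreHessian (energy F) p u w = 2⁻¹ * fibreHessian (fun p => F p ^ 2) p u w :=
  fderiv_fderiv_half (fun y : E => F ⟨p.1, y⟩ ^ 2) p.2 u w

omit [IsManifold 𝓘(ℝ, E) ∞ M] in
theorem fibreHessianPosDef_energy_iff :
    FibreHessianPosDef (energy F) ↔ FibreHessianPosDef (fun p => F p ^ 2) := by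
  refine forall₂_congr fun p _ => forall₂_congr fun u _ => ?_
  rw [fibreHessian_energy]
  constructor <;> intro h <;> linarith

theorem IsOneHomogeneous.ne_zero (hF : IsOneHomogeneous F)
    (hs : ContMDiffOn 𝓘(ℝ, E).tangent 𝓘(ℝ, ℝ) ∞ F (slit E M))
    (hpos : FibreHessianPosDef (fun p => F p ^ 2)) {p : TM E M} (hp : p ∈ slit E M) : F p ≠ 0 := by
  obtain ⟨x, y⟩ := p
  have key : ∀ y : E, (⟨x, y⟩ : TM E M) ∈ slit E M →
      fderiv ℝ (fderiv ℝ (fun y : E => F ⟨x, y⟩ ^ 2)) y y y = 2 * F ⟨x, y⟩ ^ 2 := by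
    intro y hp
    refine fderiv_fderiv_self_of_homogeneous (h := fun y : E => F ⟨x, y⟩ ^ 2) ?_ fun c hc v => ?_
    · have h1 : ContDiffAt ℝ ∞ (fun y : E => F ⟨x, y⟩) y :=
        ((hs.contMDiffAt (isOpen_slit.mem_nhds hp)).comp y (contMDiff_fibreIncl x y)).contDiffAt
      exact (h1.pow 2).of_le two_le_infty
    · have h2 : F ⟨x, c • v⟩ = c * F ⟨x, v⟩ := hF ⟨x, v⟩ c hc
      rw [h2]
      ring
  intro h0
  have h1 : 0 < fderiv ℝ (fderiv ℝ (fun y : E => F ⟨x, y⟩ ^ 2)) y y y := hpos _ hp y hp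
  have h2 := key y hp
  rw [h2, h0] at h1
  norm_num at h1

/-- Only the zero section is at issue. On a compact ball times the unit sphere `F` is bounded by
some `C`, and homogeneity spreads this to `|F| ≤ C ‖y‖` near the zero vector. -/
theorem continuous_of_homogeneous [FiniteDimensional ℝ E] (hF : IsOneHomogeneous F)
    (hs : ContMDiffOn 𝓘(ℝ, E).tangent 𝓘(ℝ, ℝ) ∞ F (slit E M)) : Continuous F := by
  have : ProperSpace E := FiniteDimensional.proper ℝ E
  rw [continuous_iff_continuousAt]
  intro p
  by_cases hp : p ∈ slit E M
  · exact (hs.contMDiffAt (isOpen_slit.mem_nhds hp)).continuousAt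
  have hp0 : p.2 = 0 := not_not.1 hp
  have hx : p.1 ∈ (chartAt E p.1).source := mem_chart_source _ _
  have hz := tchart_mem_target hx
  have hz2 := (tchart_snd_eq_zero_iff hx).2 hp0
  set z := tchart E p.1 p with hzdef
  -- Scaling by `2` fixes a zero vector, so `F = 2 F` there.
  have hzero : ∀ z' ∈ (tchart E p.1).target, z'.2 = 0 → localFun F p.1 z' = 0 := by
    intro z' h1 h2
    have h3 := hF.localFun_smul h1 (c := 2) two_pos
    have h4 : (z'.1, (2 : ℝ) • z'.2) = z' := Prod.ext rfl (by simp [h2])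
    rw [h4] at h3
    linarith
  have hz1 : z.1 ∈ (extChartAt 𝓘(ℝ, E) p.1).target := by
    rw [tchart_target] at hz
    exact hz.1
  obtain ⟨r, hr, hball⟩ := Metric.nhds_basis_closedBall.mem_iff.1
    ((isOpen_extChartAt_target (I := 𝓘(ℝ, E)) p.1).mem_nhds hz1)
  have hK : IsCompact (Metric.closedBall z.1 r ×ˢ Metric.sphere (0 : E) 1) :=
    (isCompact_closedBall _ _).prod (isCompact_sphere _ _)
  have hsub : Metric.closedBall z.1 r ×ˢ Metric.sphere (0 : E) 1 ⊆ slitTarget E p.1 := by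
    rintro z' ⟨h1, h2⟩
    refine ⟨?_, ?_⟩
    · rw [tchart_target]
      exact ⟨hball h1, trivial⟩
    · intro h0
      simp [h0] at h2
  obtain ⟨C, hC⟩ := hK.exists_bound_of_continuousOn
    ((contDiffOn_localFun hs p.1).continuousOn.mono hsub)
  have hbound : ∀ᶠ z' in 𝓝 z, ‖localFun F p.1 z'‖ ≤ C * ‖z'.2‖ := by
    filter_upwards [continuous_fst.continuousAt.preimage_mem_nhds
      (Metric.closedBall_mem_nhds z.1 hr)] with z' h1
    have htgt : ∀ y : E, (z'.1, y) ∈ (tchart E p.1).target := fun y => by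
      rw [tchart_target]
      exact ⟨hball h1, trivial⟩
    by_cases h2 : z'.2 = 0
    · simp [hzero z' (htgt z'.2) h2, h2]
    · have hn : 0 < ‖z'.2‖ := norm_pos_iff.2 h2
      have h3 := hF.localFun_smul (htgt (‖z'.2‖⁻¹ • z'.2)) hn
      have h4 : (z'.1, ‖z'.2‖ • ‖z'.2‖⁻¹ • z'.2) = z' :=
        Prod.ext rfl (by simp [smul_smul, hn.ne'])
      rw [h4] at h3
      have h5 := hC (z'.1, ‖z'.2‖⁻¹ • z'.2) ⟨h1, by simp [norm_smul, hn.ne']⟩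
      rw [h3, norm_mul, norm_norm, mul_comm]
      exact mul_le_mul_of_nonneg_right h5 hn.le
  have hg : Filter.Tendsto (localFun F p.1) (𝓝 z) (𝓝 0) := by
    refine squeeze_zero_norm' hbound ?_
    have h1 : ContinuousAt (fun z' : E × E => C * ‖z'.2‖) z := by fun_prop
    have h2 := h1.tendsto
    rwa [hz2, norm_zero, mul_zero] at h2
  have hFp : F p = 0 := by
    rw [← localFun_tchart (f := F) hx]
    exact hzero z hz hz2
  rw [ContinuousAt, hFp]
  refine (hg.comp (contMDiffAt_tchart hx).continuousAt).congr' ?_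
  filter_upwards [eventually_proj_mem hx] with q hq
  exact localFun_tchart hq

/-- The absolute value is smooth away from `0`, where `F` takes its values on the slit bundle, and
it leaves `F²` unchanged. -/
theorem IsOneHomogeneous.isFinslerFunction_abs [FiniteDimensional ℝ E] (hF : IsOneHomogeneous F)
    (hs : ContMDiffOn 𝓘(ℝ, E).tangent 𝓘(ℝ, ℝ) ∞ F (slit E M))
    (hpos : FibreHessianPosDef (fun p => F p ^ 2)) : IsFinslerFunction (fun p => |F p|) where
  continuous := (continuous_of_homogeneous hF hs).abs
  smooth p hp := ((contDiffAt_abs (hF.ne_zero hs hpos hp)).contMDiffAt.comp p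
    (hs.contMDiffAt (isOpen_slit.mem_nhds hp))).contMDiffWithinAt
  pos p hp := abs_pos.2 (hF.ne_zero hs hpos hp)
  homogeneous p c hc := by simp only [hF p c hc, abs_mul, abs_of_pos hc]
  posDef := by
    rw [fibreHessianPosDef_energy_iff]
    simpa only [sq_abs] using hpos

/-- The factor `S(F) / F` by which the geodesic spray of `F` differs from `S`. -/
def projectiveFactor (S : (p : TM E M) → TangentSpace 𝓘(ℝ, E).tangent p) (F : TM E M → ℝ)
    (p : TM E M) : ℝ := dFun F p (S p) / F p

theorem contMDiffOn_projectiveFactor (hS : IsSpray S)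
    (hs : ContMDiffOn 𝓘(ℝ, E).tangent 𝓘(ℝ, ℝ) ∞ F (slit E M)) (h0 : ∀ p ∈ slit E M, F p ≠ 0) :
    ContMDiffOn 𝓘(ℝ, E).tangent 𝓘(ℝ, ℝ) ∞ (projectiveFactor S F) (slit E M) := by
  intro p hp
  have hx : p.1 ∈ (chartAt E p.1).source := mem_chart_source _ _
  have hz := tchart_mem_slitTarget hx hp
  have h1 : ContDiffAt ℝ ∞ (fun z => fderiv ℝ (localFun F p.1) z (localField S p.1 z))
      (tchart E p.1 p) :=
    ((contDiffAt_localFun_of_slit hs hz).fderiv_right (m := ∞) (by simp)).clm_apply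
      ((contDiffOn_localField hS.smooth p.1).contDiffAt ((isOpen_slitTarget p.1).mem_nhds hz))
  have h2 : ContMDiffAt 𝓘(ℝ, E).tangent 𝓘(ℝ, ℝ) ∞ (fun q => dFun F q (S q)) p := by
    refine (h1.contMDiffAt.comp p (contMDiffAt_tchart hx)).congr_of_eventuallyEq ?_
    filter_upwards [eventually_proj_mem hx, isOpen_slit.mem_nhds hp] with q h3 h4
    rw [Function.comp_apply, localField_tchart h3,
      dFun_eq h3 (hs.contMDiffAt (isOpen_slit.mem_nhds h4))]
  exact (h2.div₀ (hs.contMDiffAt (isOpen_slit.mem_nhds hp)) (h0 p hp)).contMDiffWithinAt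

/-- `S(F)` is 2-homogeneous and `F` is 1-homogeneous, so the quotient has degree one, as needed for
`S - a C` to be a spray. -/
theorem projectiveFactor_smul (hS : IsSpray S) (hF : IsOneHomogeneous F)
    (hs : ContMDiffOn 𝓘(ℝ, E).tangent 𝓘(ℝ, ℝ) ∞ F (slit E M)) {p : TM E M} (hp : p ∈ slit E M)
    {c : ℝ} (hc : 0 < c) :
    projectiveFactor S F ⟨p.1, c • p.2⟩ = c * projectiveFactor S F p := by
  have hx : p.1 ∈ (chartAt E p.1).source := mem_chart_source _ _
  have hz := tchart_mem_slitTarget hx hp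
  have key : ∀ q : TM E M, q.1 ∈ (chartAt E p.1).source → q ∈ slit E M → dFun F q (S q) =
      fderiv ℝ (localFun F p.1) (tchart E p.1 q) (localField S p.1 (tchart E p.1 q)) := by
    intro q h1 h2
    rw [localField_tchart h1, dFun_eq h1 (hs.contMDiffAt (isOpen_slit.mem_nhds h2))]
  have h1 := key ⟨p.1, c • p.2⟩ hx (smul_mem_slit hp hc)
  rw [tchart_smul hx, hS.localField_smul hp hc] at h1
  have h2 : (c • (tchart E p.1 p).2, c ^ 2 • (localField S p.1 (tchart E p.1 p)).2) =
      c • ((localField S p.1 (tchart E p.1 p)).1, c • (localField S p.1 (tchart E p.1 p)).2) := by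
    rw [hS.localField_fst hz, Prod.smul_mk, smul_smul, pow_two]
  rw [h2, map_smul, hF.fderiv_localFun_smul hs hz hc, Prod.mk.eta, ← key p hx hp] at h1
  rw [projectiveFactor, projectiveFactor, h1, hF p c hc, smul_eq_mul,
    mul_div_mul_left _ _ hc.ne', mul_div_assoc]

end Finsler

/-! ### From the Euler-Lagrange equation to the Rapcsák equation and back. -/

section Metrizability
variable {E : Type*} [NormedAddCommGroup E] [NormedSpace ℝ E]
  {M : Type*} [TopologicalSpace M] [ChartedSpace E M]
  [IsManifold 𝓘(ℝ, E) ∞ M]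
  {S S' : (p : TM E M) → TangentSpace 𝓘(ℝ, E).tangent p} {F : TM E M → ℝ}

theorem ddJ_self {g : E × E → ℝ} {z u : E × E} : ddJ g z u u = 0 := sub_self _

theorem IsSpray.dchart_fst (hS : IsSpray S) {p : TM E M} (hp : p ∈ slit E M) :
    (dchart p.1 p (S p)).1 = (tchart E p.1 p).2 := by
  have hx : p.1 ∈ (chartAt E p.1).source := mem_chart_source _ _
  rw [← localField_tchart hx]
  exact hS.localField_fst (tchart_mem_slitTarget hx hp)

theorem RapcsakEquation.of_eulerLagrange (hF : IsOneHomogeneous F)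
    (hs : ContMDiffOn 𝓘(ℝ, E).tangent 𝓘(ℝ, ℝ) ∞ F (slit E M)) (h0 : ∀ p ∈ slit E M, F p ≠ 0)
    (hS' : IsSpray S') (hEL : ∀ p ∈ slit E M, ∀ w, eulerLagrangeForm S' (energy F) p w = 0)
    (hSS' : ∀ p ∈ slit E M, ∃ a : ℝ, S p = S' p - a • liouville p) : RapcsakEquation S F := by
  intro p hp w
  have hx : p.1 ∈ (chartAt E p.1).source := mem_chart_source _ _
  have hz := tchart_mem_slitTarget hx hp
  obtain ⟨a, ha⟩ := hSS' p hp
  rw [dOneForm_dJ hs hp, ha, map_sub, map_smul, dchart_liouville hx,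
    ddJ_sub_smul_vertical hF hs hz]
  -- Evaluating on `S'` removes the `dd_J` term by antisymmetry and leaves `S'(F) F = 0`.
  have h1 := hEL p hp (S' p)
  rw [eulerLagrangeForm_energy hF hs hp (hS'.dchart_fst hp), ddJ_self, hS'.dchart_fst hp,
    hF.fderiv_localFun hs hz, localFun_tchart hx, mul_zero, add_zero] at h1
  have h2 := (mul_eq_zero.1 h1).resolve_right (h0 p hp)
  have h3 := hEL p hp w
  rw [eulerLagrangeForm_energy hF hs hp (hS'.dchart_fst hp), h2, zero_mul, zero_add] at h3
  exact (mul_eq_zero.1 h3).resolve_left (h0 p hp)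

theorem RapcsakEquation.eulerLagrange (hF : IsOneHomogeneous F)
    (hs : ContMDiffOn 𝓘(ℝ, E).tangent 𝓘(ℝ, ℝ) ∞ F (slit E M)) (h0 : ∀ p ∈ slit E M, F p ≠ 0)
    (hS : IsSpray S) (h : RapcsakEquation S F) {p : TM E M} (hp : p ∈ slit E M)
    (w : TangentSpace 𝓘(ℝ, E).tangent p) :
    eulerLagrangeForm (fun p => S p - projectiveFactor S F p • liouville p) (energy F) p w = 0 := by
  have hx : p.1 ∈ (chartAt E p.1).source := mem_chart_source _ _
  have hz := tchart_mem_slitTarget hx hp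
  have h1 := h p hp w
  rw [dOneForm_dJ hs hp] at h1
  have h2 : dchart p.1 p (S p - projectiveFactor S F p • liouville p) =
      dchart p.1 p (S p) - projectiveFactor S F p • (0, (tchart E p.1 p).2) := by
    rw [map_sub, map_smul, dchart_liouville hx]
  -- The factor `S(F)/F` is chosen so that the new spray annihilates `F`, using `C F = F`.
  have h3 : fderiv ℝ (localFun F p.1) (tchart E p.1 p)
      (dchart p.1 p (S p) - projectiveFactor S F p • (0, (tchart E p.1 p).2)) = 0 := by
    rw [map_sub, map_smul, hF.fderiv_localFun hs hz, localFun_tchart hx,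
      ← dFun_eq hx (hs.contMDiffAt (isOpen_slit.mem_nhds hp)), projectiveFactor, smul_eq_mul,
      div_mul_cancel₀ _ (h0 p hp), sub_self]
  rw [eulerLagrangeForm_energy hF hs hp (by rw [h2]; simp [hS.dchart_fst hp]), h2, h3,
    ddJ_sub_smul_vertical hF hs hz, h1, zero_mul, mul_zero, add_zero]

/-- The reverse direction is the forward one applied to the spray `S - a C` with factor `-a`, which
leads back to `S`. -/
theorem projectivelyEquivalent_sub_smul_liouville (hS : IsSpray S) {a : TM E M → ℝ}
    (ha : ContMDiffOn 𝓘(ℝ, E).tangent 𝓘(ℝ, ℝ) ∞ a (slit E M))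
    (hom : ∀ p ∈ slit E M, ∀ c : ℝ, 0 < c → a ⟨p.1, c • p.2⟩ = c * a p) :
    ProjectivelyEquivalent S (fun p => S p - a p • liouville p) := by
  refine ⟨geodesicsReparametrizeTo_sub_smul_liouville hS ha hom, ?_⟩
  have h := geodesicsReparametrizeTo_sub_smul_liouville (hS.sub_smul_liouville ha hom)
    (a := fun p => -a p) ha.neg fun p hp c hc => by rw [hom p hp c hc, mul_neg]
  have h2 : (fun p => S p - a p • liouville p - (-a p) • liouville p) = S := by
    funext p
    rw [neg_smul, sub_neg_eq_add, sub_add_cancel]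
  exact Eq.mp (congrArg (GeodesicsReparametrizeTo (fun p => S p - a p • liouville p)) h2) h

end Metrizability

end SprayGeometry

end

/-! ### The equivalence. -/

theorem mainTheorem3 (E : Type*) [NormedAddCommGroup E] [NormedSpace ℝ E] [FiniteDimensional ℝ E]
    (M : Type*) [TopologicalSpace M] [ChartedSpace E M] [IsManifold 𝓘(ℝ, E) ∞ M]
    (S : (p : SprayGeometry.TM E M) → TangentSpace 𝓘(ℝ, E).tangent p)
    (hS : SprayGeometry.IsSpray S) :
    SprayGeometry.IsProjectivelyFinslerMetrizable S ↔
      ∃ F : SprayGeometry.TM E M → ℝ,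
        ContMDiffOn 𝓘(ℝ, E).tangent 𝓘(ℝ, ℝ) ∞ F (SprayGeometry.slit E M) ∧
        SprayGeometry.IsOneHomogeneous F ∧
        SprayGeometry.FibreHessianPosDef (fun p => F p ^ 2) ∧
        SprayGeometry.RapcsakEquation S F := by
  have : CompleteSpace E := FiniteDimensional.complete ℝ E
  constructor
  · rintro ⟨S', hS', hSS', F, hF, hEL⟩
    exact ⟨F, hF.smooth, hF.homogeneous, SprayGeometry.fibreHessianPosDef_energy_iff.1 hF.posDef,
      .of_eulerLagrange hF.homogeneous hF.smooth (fun p hp => (hF.pos p hp).ne') hS' hEL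
        -- The Rapcsák equation is pointwise, so a factor `a` at each point suffices, without any
        -- regularity in `p`.
        fun p hp => hSS'.2.exists_eq_sub_smul_liouville hS' hS hp⟩
  · rintro ⟨F, hs, hF, hpos, hR⟩
    have h0 : ∀ p ∈ SprayGeometry.slit E M, F p ≠ 0 := fun p hp => hF.ne_zero hs hpos hp
    have ha := SprayGeometry.contMDiffOn_projectiveFactor hS hs h0
    have hom : ∀ p ∈ SprayGeometry.slit E M, ∀ c : ℝ, 0 < c →
        SprayGeometry.projectiveFactor S F ⟨p.1, c • p.2⟩ =
          c * SprayGeometry.projectiveFactor S F p := fun p hp c hc =>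
      SprayGeometry.projectiveFactor_smul hS hF hs hp hc
    refine ⟨fun p => S p - SprayGeometry.projectiveFactor S F p • SprayGeometry.liouville p,
      hS.sub_smul_liouville ha hom,
      SprayGeometry.projectivelyEquivalent_sub_smul_liouville hS ha hom,
      fun p => |F p|, hF.isFinslerFunction_abs hs hpos, fun p hp w => ?_⟩
    have hE : SprayGeometry.energy (fun p => |F p|) = SprayGeometry.energy F := by
      funext p
      simp only [SprayGeometry.energy, sq_abs]
    rw [hE]
    exact hR.eulerLagrange hF hs h0 hS hp w
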